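/- Rainbow partial embedding lemma. For all $d\in(0,1]$ and all integers $\Delta\ge 1$ there is $d_0>0$ such that for every $0<d'\le d_0$ there is $\varepsilon_0>0$ such that for every integer $r\ge 1$ there is $\mu_0>0$ such that for all $0<\varepsilon\le\varepsilon_0$ and $0<\mu\le\mu_0$ there is $n_0$ such that the following holds for all $n\ge n_0$. Let $R$ be a graph on $[r]$. Let $G$ be a graph on $n$ vertices with vertex partition $(V_i)_{i\in[r]}$ such that $(1-\varepsilon)n/r\le |V_i|\le(1+\varepsilon)n/r$ for all $i\in[r]$ and such that, whenever $ij\in E(R)$, the bipartite graph $G[V_i,V_j]$ is lower $(\varepsilon,d)$-regular, that is, $e_G(S,T)/(|S||T|)\ge d-\varepsilon$ for all $S\subseteq V_i$, $T\subseteq V_j$ with $|S|\ge\varepsilon|V_i|$ and $|T|\ge\varepsilon|V_j|$. Let $H$ be a graph on at most $\varepsilon n/r$ vertices with maximum degree at most $\Delta$ and with vertex partition $(X_1,\dots,X_r,Y_1,\dots,Y_r)$ (parts may be empty) such that $Z_i:=X_i\cup Y_i$ is an independent set for all $i\in[r]$ and such that $ij\in E(R)$ whenever $H$ has an edge between $Z_i$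 and $Z_j$. Put $X:=X_1\cup\dots\cup X_r$ and $Y:=Y_1\cup\dots\cup Y_r$. Let $c\colon E(G)\to C$ be an edge colouring in which each colour appears on at most $\mu n$ edges, and for $A\subseteq C$ let $G_A$ be the spanning subgraph of $G$ whose edges are the edges of $G$ with colour in $A$. Then there exist a set of colours $C'\subseteq C$, an injective graph homomorphism $\phi\colon H[X]\to G_{C\setminus C'}$ which is rainbow (distinct edges of $H[X]$ are mapped to edges of different colours), and sets $S_y\subseteq V_i$ for all $i\in[r]$ and $y\in Y_i$, such that (i) $\phi(X_i)\subseteq V_i$ for all $i\in[r]$; (ii) for all $y\in Y$ we have $|S_y|\ge d'n/r$, and $S_y\subseteq N_{G_{C'}}(\phi(x))$ for all $x\in N_H(y)\cap X$; (iii) for all $y\in Y$, all distinct $x,x'\in N_H(y)\cap X$ and all $v\in S_y$, we have $c(\phi(x)v)\ne c(\phi(x')v)$. -/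

import Mathlib

universe u v w

namespace RainbowEmbedding

/-- The members of the family `P` are pairwise disjoint and cover `V`
(members are allowed to be empty). -/
def IsVertexPartition {V ι : Type*} (P : ι → Set V) : Prop :=
  ∀ v : V, ∃! i : ι, v ∈ P i

/-- For disjoint vertex sets `A`, `B`, the bipartite graph `G[A, B]` is lower `(ε, d)`-regular. -/
def IsLowerRegular {V : Type*} (G : SimpleGraph V) [DecidableRel G.Adj] (ε d : ℝ)
    (A B : Finset V) : Prop :=
  ∀ S ⊆ A, ∀ T ⊆ B, ε * (A.card : ℝ) ≤ (S.card : ℝ) → ε * (B.card : ℝ) ≤ (T.card : ℝ) →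
    d - ε ≤ (G.edgeDensity S T : ℝ)

/-- Each colour appears on at most `k` edges. -/
def IsBoundedColouring {V C : Type*} {G : SimpleGraph V} (c : G.EdgeLabeling C) (k : ℝ) : Prop :=
  ∀ α : C, ({e : G.edgeSet | c e = α}.ncard : ℝ) ≤ k

/-- The spanning subgraph of `G` formed by the edges whose colour lies in `A`. -/
def colourSubgraph {V C : Type*} {G : SimpleGraph V} (c : G.EdgeLabeling C) (A : Set C) :
    SimpleGraph V where
  Adj u v := ∃ h : G.Adj u v, c.get u v h ∈ A
  symm := ⟨fun u v ⟨h, hc⟩ => ⟨h.symm, by rw [c.get_comm]; exact hc⟩⟩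
  loopless := ⟨fun _ ⟨h, _⟩ => h.ne rfl⟩

theorem colourSubgraph_le {V C : Type*} {G : SimpleGraph V} (c : G.EdgeLabeling C) (A : Set C) :
    colourSubgraph c A ≤ G :=
  fun _ _ h => h.1

/-- Distinct edges of `F` are mapped by `f` to edges of `G` of different colours. -/
def IsRainbow {U V C : Type*} {F : SimpleGraph U} {G : SimpleGraph V} (c : G.EdgeLabeling C)
    (f : F →g G) : Prop :=
  Function.Injective (c.pullback f)

end RainbowEmbedding

/-! With `K` = Δ + Δ² + 1, split the colours at random into `K + 1` classes. No colour carries more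
than μn edges, so an exponential moment bound survives a union bound over the 4ⁿ pairs of vertex
sets: every class keeps density at least `g` = d / (4(K + 1)) between large subsets of a regular
pair (`exists_colour_classes`, `IsLowerRegular.colour_class_dense`).

Rank X by 0, ..., K - 1 so that vertices at distance at most two in H get different ranks, and give
Y rank K (`exists_rank`). The ranks are embedded one at a time; edges to a vertex of rank k use
class k, and class K becomes C'. Hence a colour can repeat only among edges to the same rank. A
vertex has at most one neighbour in each rank below K, so its candidate set shrinks by a factor of
at worst `g` per step, and by `β` = g ^ K in all.

Most candidates of a vertex are good images (`le_card_good`). One rank may contain linearly many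
vertices; they are placed simultaneously by a conflict-free transversal
(`exists_independent_transversal`). Distinct colours at a common neighbour are ensured by keeping
sets `sameColour` small for embedded vertices with a common neighbour in H: then few candidates see
a colour twice, and these are discarded, finally also for the vertices of Y. -/

namespace RainbowEmbedding

open Finset

/-! ### Random splitting, transversals and greedy colouring -/

/-- A finite set of colours can be partitioned into `K` classes such that each of the given
weight functions puts almost a `1 / K` fraction of its total weight on each class. -/
theorem exists_balanced_partition {ι J : Type*} [Fintype ι] [Fintype J] (a : J → ι → ℝ) {K : ℕ}
    (hK : 0 < K) {M L lam t : ℝ} (ha : ∀ j i, 0 ≤ a j i) (haM : ∀ j i, a j i ≤ M)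
    (hM : 0 ≤ M) (hlam : 0 < lam) (hL : ∀ j, ∑ i, a j i ≤ L)
    (h : Fintype.card J * K * Real.exp (-lam * t + lam ^ 2 * M * L / K) < 1) :
    ∃ κ : ι → Fin K, ∀ j k, (∑ i, a j i) / K - t ≤ ∑ i, if κ i = k then a j i else 0 := by
  classical
  have hK' : (0 : ℝ) < K := by exact_mod_cast hK
  by_contra! hcon
  -- This follows from exp x ≥ 1 + x, because (1 + x)(1 - x + x²) = 1 + x³ ≥ 1.
  have hexp : ∀ x : ℝ, 0 ≤ x → Real.exp (-x) ≤ 1 - x + x ^ 2 := by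
    intro x hx
    rw [Real.exp_neg, inv_le_comm₀ (Real.exp_pos x) (by nlinarith [sq_nonneg (x - 1)])]
    refine le_trans ?_ (Real.add_one_le_exp x)
    rw [inv_le_iff_one_le_mul₀ (by nlinarith [sq_nonneg (x - 1)])]
    nlinarith [pow_nonneg hx 3]
  have hinner : ∀ (k : Fin K) (x : ℝ), 0 ≤ x →
      ∑ b : Fin K, Real.exp (-(if b = k then x else 0)) ≤ K * Real.exp ((-x + x ^ 2) / K) := by
    intro k x hx
    have h1 : ∑ b : Fin K, Real.exp (-(if b = k then x else 0))
        = ∑ b : Fin K, (1 + if b = k then Real.exp (-x) - 1 else 0) := by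
      refine sum_congr rfl fun b _ => ?_
      split_ifs <;> simp
    rw [h1, sum_add_distrib, sum_ite_eq' univ k]
    simp only [sum_const, card_univ, Fintype.card_fin, nsmul_eq_mul, mul_one, mem_univ, if_true]
    calc (K : ℝ) + (Real.exp (-x) - 1) ≤ K * ((-x + x ^ 2) / K + 1) := by
          have := hexp x hx
          field_simp
          linarith
      _ ≤ _ := by gcongr; exact Real.add_one_le_exp _
  -- Exponential moment of the deficit under a uniformly random κ, multiplied by the number of maps
  -- κ. Independence factorises the sum; the linear terms cancel against the mean, and a² ≤ M a
  -- bounds the quadratic ones.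
  have hterm : ∀ j k, ∑ κ : ι → Fin K,
      Real.exp (lam * ((∑ i, a j i) / K - t - ∑ i, if κ i = k then a j i else 0))
      ≤ (K : ℝ) ^ Fintype.card ι * Real.exp (-lam * t + lam ^ 2 * M * L / K) := by
    intro j k
    have h1 : ∀ κ : ι → Fin K,
        Real.exp (lam * ((∑ i, a j i) / K - t - ∑ i, if κ i = k then a j i else 0))
        = Real.exp (lam * ((∑ i, a j i) / K - t)) *
          ∏ i, Real.exp (-(if κ i = k then lam * a j i else 0)) := by
      intro κ
      rw [← Real.exp_sum, ← Real.exp_add]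
      congr 1
      rw [sum_neg_distrib, mul_sub, mul_sum, sub_eq_add_neg]
      simp only [mul_ite, mul_zero]
    simp_rw [h1]
    rw [← mul_sum, ← Fintype.prod_sum (fun i (b : Fin K) =>
      Real.exp (-(if b = k then lam * a j i else 0)))]
    have h2 : ∏ i, ∑ b : Fin K, Real.exp (-(if b = k then lam * a j i else 0))
        ≤ ∏ i, (K * Real.exp ((-(lam * a j i) + (lam * a j i) ^ 2) / K)) :=
      prod_le_prod (fun i _ => sum_nonneg fun b _ => (Real.exp_pos _).le)
        (fun i _ => hinner k _ (mul_nonneg hlam.le (ha j i)))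
    rw [prod_mul_distrib, prod_const, card_univ, ← Real.exp_sum] at h2
    refine (mul_le_mul_of_nonneg_left h2 (Real.exp_pos _).le).trans ?_
    rw [mul_left_comm, ← Real.exp_add]
    refine mul_le_mul_of_nonneg_left (Real.exp_le_exp.2 ?_) (by positivity)
    rw [← sum_div, sum_add_distrib, sum_neg_distrib, ← mul_sum]
    have h3 : ∑ i, (lam * a j i) ^ 2 ≤ lam ^ 2 * M * L := by
      calc ∑ i, (lam * a j i) ^ 2 ≤ ∑ i, lam ^ 2 * M * a j i := by
            refine sum_le_sum fun i _ => ?_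
            have := mul_le_mul_of_nonneg_left (haM j i) (mul_nonneg (sq_nonneg lam) (ha j i))
            nlinarith
        _ = lam ^ 2 * M * ∑ i, a j i := by rw [mul_sum]
        _ ≤ _ := by gcongr; exact hL j
    have h4 := div_le_div_of_nonneg_right h3 hK'.le
    rw [add_div]
    have : lam * ((∑ i, a j i) / K) = lam * (∑ i, a j i) / K := by ring
    rw [mul_sub, this, neg_div]
    linarith
  -- If every κ fails for some (j, k), each contributes at least 1, contradicting the moment bound
  -- summed over all (j, k).
  have hlow : (K : ℝ) ^ Fintype.card ι ≤ ∑ κ : ι → Fin K, ∑ j : J, ∑ k : Fin K,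
      Real.exp (lam * ((∑ i, a j i) / K - t - ∑ i, if κ i = k then a j i else 0)) := by
    have : (K : ℝ) ^ Fintype.card ι = ∑ κ : ι → Fin K, (1 : ℝ) := by simp
    rw [this]
    refine sum_le_sum fun κ _ => ?_
    obtain ⟨j, k, hjk⟩ := hcon κ
    calc (1 : ℝ) ≤ Real.exp (lam * ((∑ i, a j i) / K - t - ∑ i, if κ i = k then a j i else 0)) :=
          Real.one_le_exp (mul_nonneg hlam.le (by linarith))
      _ ≤ ∑ k : Fin K, Real.exp
            (lam * ((∑ i, a j i) / K - t - ∑ i, if κ i = k then a j i else 0)) :=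
          single_le_sum (f := fun k => Real.exp
            (lam * ((∑ i, a j i) / K - t - ∑ i, if κ i = k then a j i else 0)))
            (fun _ _ => (Real.exp_pos _).le) (mem_univ k)
      _ ≤ _ := single_le_sum (f := fun j => ∑ k : Fin K, Real.exp
            (lam * ((∑ i, a j i) / K - t - ∑ i, if κ i = k then a j i else 0)))
            (fun _ _ => sum_nonneg fun _ _ => (Real.exp_pos _).le) (mem_univ j)
  have hup : ∑ κ : ι → Fin K, ∑ j : J, ∑ k : Fin K,
      Real.exp (lam * ((∑ i, a j i) / K - t - ∑ i, if κ i = k then a j i else 0))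
      ≤ ∑ j : J, ∑ k : Fin K,
        (K : ℝ) ^ Fintype.card ι * Real.exp (-lam * t + lam ^ 2 * M * L / K) := by
    rw [sum_comm]
    refine sum_le_sum fun j _ => ?_
    rw [sum_comm]
    exact sum_le_sum fun k _ => hterm j k
  simp only [sum_const, card_univ, Fintype.card_fin, nsmul_eq_mul] at hup
  have hpos : (0 : ℝ) < (K : ℝ) ^ Fintype.card ι := by positivity
  nlinarith

open Classical in
/-- If every part is large compared with the number of conflicts of each of its elements, then
there is a choice of one element from each part without conflicts. -/
theorem exists_independent_transversal {ι β : Type*} [Fintype ι] [Fintype β]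
    (A : ι → Finset β) (r : ι → β → ι → β → Prop) (hr : ∀ i v j w, r i v j w → r j w i v)
    {m D : ℝ} (hm : 0 < m) (hD : 4 * D ≤ m) (hA : ∀ i, m ≤ #(A i))
    (hdeg : ∀ i, ∀ v ∈ A i,
      (#{p : ι × β | p.1 ≠ i ∧ p.2 ∈ A p.1 ∧ r i v p.1 p.2} : ℝ) ≤ D) :
    ∃ f : ι → β, (∀ i, f i ∈ A i) ∧ ∀ i j, i ≠ j → ¬ r i (f i) j (f j) := by
  rcases isEmpty_or_nonempty ι with hι | ⟨⟨i₀⟩⟩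
  · exact ⟨fun i => hι.elim i, fun i => hι.elim i, fun i => hι.elim i⟩
  have hne : (A i₀).Nonempty := by
    rw [← card_pos]; exact_mod_cast hm.trans_le (hA i₀)
  obtain ⟨b₀, -⟩ := hne
  -- Conflict-free partial choices on S, padded by `b₀` outside S so that they can be counted as
  -- total functions. The proof counts them: the number grows by a factor of at least m / 2 with
  -- each new part.
  let T : Finset ι → Finset (ι → β) := fun S => {f | (∀ i ∈ S, f i ∈ A i) ∧ (∀ i ∉ S, f i = b₀) ∧
    ∀ i ∈ S, ∀ j ∈ S, i ≠ j → ¬ r i (f i) j (f j)}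
  have hT : ∀ S f, f ∈ T S ↔ (∀ i ∈ S, f i ∈ A i) ∧ (∀ i ∉ S, f i = b₀) ∧
    ∀ i ∈ S, ∀ j ∈ S, i ≠ j → ¬ r i (f i) j (f j) := fun S f => by simp [T]
  have hfib : ∀ S, ∀ j ∈ S, ∀ w, #{f ∈ T S | f j = w} ≤ #(T (S.erase j)) := by
    intro S j hj w
    refine card_le_card_of_injOn (fun f => Function.update f j b₀) ?_ ?_
    · intro f hf
      simp only [mem_coe, mem_filter, hT] at hf
      obtain ⟨⟨h1, h2, h3⟩, h4⟩ := hf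
      simp only [mem_coe, hT, mem_erase]
      refine ⟨fun i hi => ?_, fun i hi => ?_, fun i hi k hk hik => ?_⟩
      · rw [Function.update_of_ne hi.1]; exact h1 i hi.2
      · by_cases hij : i = j
        · subst hij; simp
        · rw [Function.update_of_ne hij]; exact h2 i fun h => hi ⟨hij, h⟩
      · rw [Function.update_of_ne hi.1, Function.update_of_ne hk.1]
        exact h3 i hi.2 k hk.2 hik
    · intro f hf g hg hfg
      simp only [mem_coe, mem_filter] at hf hg
      funext i
      by_cases hij : i = j
      · subst hij; rw [hf.2, hg.2]
      · have := congrFun hfg i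
        simpa only [Function.update_of_ne hij] using this
  have hgrow : ∀ n : ℕ, ∀ S : Finset ι, #S = n → ∀ z ∉ S,
      m / 2 * #(T S) ≤ (#(T (insert z S)) : ℝ) := by
    intro n
    induction n using Nat.strong_induction_on with
    | _ n ih =>
    intro S hS z hz
    have hbad : ∀ v ∈ A z, (#{f ∈ T S | ∃ j ∈ S, r z v j (f j)} : ℝ) ≤ #(T S) / 2 := by
      intro v hv
      let Q : Finset (ι × β) := {p : ι × β | p.1 ≠ z ∧ p.2 ∈ A p.1 ∧ r z v p.1 p.2}
      have h1 : ({f ∈ T S | ∃ j ∈ S, r z v j (f j)} : Finset (ι → β)) ⊆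
          ({p ∈ Q | p.1 ∈ S} : Finset _).biUnion fun p => {f ∈ T S | f p.1 = p.2} := by
        intro f hf
        obtain ⟨hf, j, hj, hrj⟩ := mem_filter.1 hf
        simp only [mem_biUnion, mem_filter]
        refine ⟨(j, f j), ⟨?_, hj⟩, hf, rfl⟩
        simp only [Q, mem_filter, mem_univ, true_and]
        exact ⟨fun h => hz (h ▸ hj), ((hT S f).1 hf).1 j hj, hrj⟩
      -- Fixing the value at one index of S leaves at most the choices on the rest of S, which by
      -- induction number at most 2 / m times those on S. At most D ≤ m / 4 conflicts then spoil at
      -- most half of `T S`.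
      have h2 : ∀ p ∈ ({p ∈ Q | p.1 ∈ S} : Finset _),
          (#{f ∈ T S | f p.1 = p.2} : ℝ) ≤ 2 / m * #(T S) := by
        intro p hp
        have hpS := (mem_filter.1 hp).2
        have h3 := ih (#(S.erase p.1)) (by rw [← hS]; exact card_erase_lt_of_mem hpS)
          (S.erase p.1) rfl p.1 (notMem_erase _ _)
        rw [insert_erase hpS] at h3
        have h4 : (#{f ∈ T S | f p.1 = p.2} : ℝ) ≤ #(T (S.erase p.1)) := by
          exact_mod_cast hfib S p.1 hpS p.2
        rw [div_mul_eq_mul_div, le_div_iff₀ hm]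
        nlinarith
      calc (#{f ∈ T S | ∃ j ∈ S, r z v j (f j)} : ℝ)
          ≤ ∑ p ∈ ({p ∈ Q | p.1 ∈ S} : Finset _), (#{f ∈ T S | f p.1 = p.2} : ℝ) := by
            exact_mod_cast (card_le_card h1).trans card_biUnion_le
        _ ≤ ∑ p ∈ ({p ∈ Q | p.1 ∈ S} : Finset _), 2 / m * #(T S) := sum_le_sum h2
        _ = #({p ∈ Q | p.1 ∈ S} : Finset _) * (2 / m * #(T S)) := by
            rw [sum_const, nsmul_eq_mul]
        _ ≤ m / 4 * (2 / m * #(T S)) := by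
            gcongr
            calc (#({p ∈ Q | p.1 ∈ S} : Finset _) : ℝ) ≤ #Q := by
                  exact_mod_cast card_le_card (filter_subset _ _)
              _ ≤ D := hdeg z v hv
              _ ≤ m / 4 := by linarith
        _ = _ := by field_simp; norm_num
    have hgood : ∀ v ∈ A z, (#(T S) : ℝ) / 2 ≤ #{f ∈ T S | ¬ ∃ j ∈ S, r z v j (f j)} := by
      intro v hv
      have h1 := hbad v hv
      have h2 : (#{f ∈ T S | ∃ j ∈ S, r z v j (f j)} : ℝ) +
          #{f ∈ T S | ¬ ∃ j ∈ S, r z v j (f j)} = #(T S) := by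
        exact_mod_cast card_filter_add_card_filter_not (s := T S) _
      linarith
    have hcard : ∑ v ∈ A z, #{f ∈ T S | ¬ ∃ j ∈ S, r z v j (f j)} ≤ #(T (insert z S)) := by
      rw [← card_sigma]
      refine card_le_card_of_injOn (fun p => Function.update p.2 z p.1) ?_ ?_
      · rintro ⟨v, f⟩ hp
        simp only [coe_sigma, Set.mem_sigma_iff, mem_coe, mem_filter, hT] at hp
        obtain ⟨hv, ⟨h1, h2, h3⟩, h4⟩ := hp
        have hne : ∀ i ∈ S, i ≠ z := fun i hi h => hz (h ▸ hi)
        simp only [mem_coe, hT, mem_insert, not_or]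
        refine ⟨?_, fun i hi => ?_, ?_⟩
        · rintro i (rfl | hi)
          · simpa using hv
          · rw [Function.update_of_ne (hne i hi)]; exact h1 i hi
        · rw [Function.update_of_ne hi.1]; exact h2 i hi.2
        · rintro i (rfl | hi) j (rfl | hj) hij
          · exact absurd rfl hij
          · rw [Function.update_self, Function.update_of_ne (hne j hj)]
            exact fun h => h4 ⟨j, hj, h⟩
          · rw [Function.update_self, Function.update_of_ne (hne i hi)]
            exact fun h => h4 ⟨i, hi, hr _ _ _ _ h⟩
          · rw [Function.update_of_ne (hne i hi), Function.update_of_ne (hne j hj)]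
            exact h3 i hi j hj hij
      · rintro ⟨v, f⟩ hp ⟨w, g⟩ hq hfg
        simp only [coe_sigma, Set.mem_sigma_iff, mem_coe, mem_filter, hT] at hp hq
        have hvw : v = w := by simpa using congrFun hfg z
        subst hvw
        have : f = g := by
          funext i
          by_cases hi : i = z
          · subst hi; rw [hp.2.1.2.1 _ hz, hq.2.1.2.1 _ hz]
          · have := congrFun hfg i
            simpa only [Function.update_of_ne hi] using this
        rw [this]
    calc m / 2 * #(T S) = m * (#(T S) / 2) := by ring
      _ ≤ #(A z) * (#(T S) / 2) := by gcongr; exact hA z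
      _ = ∑ v ∈ A z, (#(T S) : ℝ) / 2 := by rw [sum_const, nsmul_eq_mul]
      _ ≤ ∑ v ∈ A z, (#{f ∈ T S | ¬ ∃ j ∈ S, r z v j (f j)} : ℝ) := sum_le_sum hgood
      _ ≤ _ := by exact_mod_cast hcard
  have hpos : ∀ S, 0 < #(T S) := by
    intro S
    induction S using Finset.induction_on with
    | empty => exact card_pos.2 ⟨fun _ => b₀, by simp [hT]⟩
    | insert z S hz ih =>
      have h1 := hgrow _ S rfl z hz
      have h2 : (0 : ℝ) < #(T S) := by exact_mod_cast ih
      have h3 : (0 : ℝ) < #(T (insert z S)) := lt_of_lt_of_le (by positivity) h1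
      exact_mod_cast h3
  obtain ⟨f, hf⟩ := card_pos.1 (hpos univ)
  obtain ⟨h1, -, h3⟩ := (hT _ _).1 hf
  exact ⟨f, fun i => h1 i (mem_univ i), fun i j => h3 i (mem_univ i) j (mem_univ j)⟩

open Classical in
/-- Greedy colouring: a symmetric relation of degree at most `D` is properly coloured
by `D + 1` colours. -/
theorem exists_greedy_colouring {W : Type*} [Fintype W] (r : W → W → Prop)
    (hr : ∀ v w, r v w → r w v) {D : ℕ} (hD : ∀ v, #{w | r v w} ≤ D) :
    ∃ q : W → ℕ, (∀ v, q v < D + 1) ∧ ∀ v w, v ≠ w → r v w → q v ≠ q w := by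
  suffices H : ∀ S : Finset W, ∃ q : W → ℕ, (∀ v, q v < D + 1) ∧
      ∀ v ∈ S, ∀ w ∈ S, v ≠ w → r v w → q v ≠ q w by
    obtain ⟨q, h1, h2⟩ := H univ
    exact ⟨q, h1, fun v w => h2 v (mem_univ v) w (mem_univ w)⟩
  intro S
  induction S using Finset.induction_on with
  | empty => exact ⟨fun _ => 0, by simp, by simp⟩
  | insert z S hz ih =>
    obtain ⟨q, h1, h2⟩ := ih
    obtain ⟨k, hk, hk'⟩ : ∃ k ∈ range (D + 1), k ∉ ({w | r z w} : Finset W).image q := by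
      refine exists_mem_notMem_of_card_lt_card ?_
      rw [card_range]
      exact Nat.lt_succ_of_le (card_image_le.trans (hD z))
    have hkq : ∀ w, r z w → q w ≠ k := fun w hw h => hk' (mem_image.2 ⟨w, by simpa using hw, h⟩)
    refine ⟨Function.update q z k, fun v => ?_, ?_⟩
    · by_cases hv : v = z
      · subst hv; simpa using hk
      · rw [Function.update_of_ne hv]; exact h1 v
    · have hne : ∀ i ∈ S, i ≠ z := fun i hi h => hz (h ▸ hi)
      simp only [mem_insert]
      rintro i (rfl | hi) j (rfl | hj) hij hrij
      · exact absurd rfl hij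
      · rw [Function.update_self, Function.update_of_ne (hne j hj)]
        exact (hkq j hrij).symm
      · rw [Function.update_self, Function.update_of_ne (hne i hi)]
        exact hkq i (hr _ _ hrij)
      · rw [Function.update_of_ne (hne i hi), Function.update_of_ne (hne j hj)]
        exact h2 i hi j hj hij hrij

/-! ### Colour classes and typical vertices -/

open Classical in
/-- The colours of a globally bounded (partial) colouring of the pairs of vertices can be
partitioned into `K` classes such that between any two vertex sets each class has almost its fair
share of the coloured pairs. -/
theorem exists_colour_classes {V C : Type*} [Fintype V] (cc : V → V → Option C) {K : ℕ}
    (hK : 0 < K) {μ δ : ℝ} (hμ : 0 < μ) (hδ : 0 < δ) (h : 8 * (K + 3) * μ ≤ K * δ ^ 2)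
    (hn : 0 < Fintype.card V)
    (hb : ∀ α, (#{p : V × V | cc p.1 p.2 = some α} : ℝ) ≤ 2 * μ * Fintype.card V) :
    ∃ κ : C → Fin K, ∀ (S T : Finset V) (k : Fin K),
      (#{p ∈ S ×ˢ T | ∃ α, cc p.1 p.2 = some α} : ℝ) / K - δ * (Fintype.card V : ℝ) ^ 2 ≤
        #{p ∈ S ×ˢ T | ∃ α, cc p.1 p.2 = some α ∧ κ α = k} := by
  set n := Fintype.card V with hn_def
  have hn1 : (1 : ℝ) ≤ n := by exact_mod_cast hn
  have hK1 : (1 : ℝ) ≤ K := by exact_mod_cast hK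
  -- C may be infinite; only the finitely many colours in use are split, and the others go to class
  -- 0.
  let U : Set C := {α | ∃ p : V × V, cc p.1 p.2 = some α}
  have hU : Finite U := by
    have : Function.Injective (fun α : U => α.2.choose) := by
      intro α β hαβ
      have h1 := α.2.choose_spec
      have h2 := β.2.choose_spec
      simp only at hαβ
      rw [hαβ, h2] at h1
      exact Subtype.ext (Option.some.inj h1).symm
    exact Finite.of_injective _ this
  have : Fintype U := Fintype.ofFinite U
  have hsum : ∀ Q : Finset (V × V), (∀ p ∈ Q, ∃ α, cc p.1 p.2 = some α) →
      ∑ α : U, #{p ∈ Q | cc p.1 p.2 = some α.1} = #Q := by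
    intro Q hQ
    rw [← card_biUnion]
    · congr 1
      ext p
      simp only [mem_biUnion, mem_univ, true_and, mem_filter]
      constructor
      · rintro ⟨α, hp, -⟩; exact hp
      · intro hp
        obtain ⟨α, hα⟩ := hQ p hp
        exact ⟨⟨α, p, hα⟩, hp, hα⟩
    · intro α _ β _ hαβ
      rw [Function.onFun, disjoint_left]
      intro p hp hp'
      have h1 := (mem_filter.1 hp).2
      rw [(mem_filter.1 hp').2] at h1
      exact hαβ (Subtype.ext (Option.some.inj h1).symm)
  obtain ⟨κ, hκ⟩ := exists_balanced_partition (ι := U) (J := Finset V × Finset V)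
    (fun j α => (#{p ∈ j.1 ×ˢ j.2 | cc p.1 p.2 = some α.1} : ℝ)) hK
    -- This `lam` minimises the exponent, giving -(K δ² / (8 μ)) n ≤ -(K + 3) n. That beats 4ⁿ ≤
    -- exp(2n) pairs of sets and K ≤ exp(Kn) classes for every n ≥ 1.
    (M := 2 * μ * n) (L := (n : ℝ) ^ 2) (lam := δ * K / (4 * μ * n)) (t := δ * (n : ℝ) ^ 2)
    (fun _ _ => by positivity)
    (fun j α => le_trans (by exact_mod_cast card_le_card (filter_subset_filter _ (subset_univ _)))
      (hb α.1))
    (by positivity) (by positivity)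
    (fun j => by
      have h1 : ∑ α : U, #{p ∈ j.1 ×ˢ j.2 | cc p.1 p.2 = some α.1} ≤ n ^ 2 := by
        have h2 := hsum {p ∈ j.1 ×ˢ j.2 | ∃ α, cc p.1 p.2 = some α}
          (fun p hp => (mem_filter.1 hp).2)
        have h3 : ∀ α : U, #{p ∈ j.1 ×ˢ j.2 | cc p.1 p.2 = some α.1} ≤
            #{p ∈ ({p ∈ j.1 ×ˢ j.2 | ∃ α, cc p.1 p.2 = some α} : Finset _) |
              cc p.1 p.2 = some α.1} := by
          intro α
          refine card_le_card fun p hp => ?_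
          rw [mem_filter] at hp
          exact mem_filter.2 ⟨mem_filter.2 ⟨hp.1, _, hp.2⟩, hp.2⟩
        refine (sum_le_sum fun α _ => h3 α).trans (h2.le.trans ?_)
        refine (card_le_univ _).trans ?_
        rw [Fintype.card_prod, sq]
      exact_mod_cast h1)
    (by
      have hexponent : -(δ * K / (4 * μ * n)) * (δ * (n : ℝ) ^ 2) +
          (δ * K / (4 * μ * n)) ^ 2 * (2 * μ * n) * (n : ℝ) ^ 2 / K =
          -(K * δ ^ 2 / (8 * μ)) * n := by
        field_simp
        ring
      have h1 : ((K : ℝ) + 3) ≤ K * δ ^ 2 / (8 * μ) := by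
        rw [le_div_iff₀ (by positivity)]; linarith
      have h2 : (4 : ℝ) ^ n ≤ Real.exp (2 * n) := by
        rw [mul_comm, Real.exp_nat_mul]
        gcongr
        have h3 := Real.add_one_le_exp (1 : ℝ)
        have h4 : Real.exp 2 = Real.exp 1 * Real.exp 1 := by rw [← Real.exp_add]; norm_num
        nlinarith
      have h3 : (K : ℝ) ≤ Real.exp (K * n) := by
        refine le_trans ?_ (Real.add_one_le_exp _)
        nlinarith
      rw [hexponent]
      have hJ : (Fintype.card (Finset V × Finset V) : ℝ) = 4 ^ n := by
        rw [Fintype.card_prod, Fintype.card_finset, ← mul_pow, ← hn_def]; norm_num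
      rw [hJ]
      calc (4 : ℝ) ^ n * K * Real.exp (-(K * δ ^ 2 / (8 * μ)) * n)
          ≤ Real.exp (2 * n) * Real.exp (K * n) * Real.exp (-(K + 3) * n) := by
            gcongr
        _ = Real.exp (-n) := by
            rw [← Real.exp_add, ← Real.exp_add]; congr 1; ring
        _ < 1 := by rw [Real.exp_lt_one_iff]; linarith)
  refine ⟨fun α => if h : α ∈ U then κ ⟨α, h⟩ else ⟨0, hK⟩, fun S T k => ?_⟩
  have h1 := hκ (S, T) k
  simp only at h1
  have h2 : (∑ α : U, (#{p ∈ S ×ˢ T | cc p.1 p.2 = some α.1} : ℝ)) =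
      #{p ∈ S ×ˢ T | ∃ α, cc p.1 p.2 = some α} := by
    rw [← hsum {p ∈ S ×ˢ T | ∃ α, cc p.1 p.2 = some α} (fun p hp => (mem_filter.1 hp).2)]
    push_cast
    refine sum_congr rfl fun α _ => ?_
    congr 2
    ext p
    simp only [mem_filter]
    exact ⟨fun h => ⟨⟨h.1, _, h.2⟩, h.2⟩, fun h => ⟨h.1.1, h.2⟩⟩
  rw [h2] at h1
  refine h1.trans (le_of_eq ?_)
  rw [← hsum {p ∈ S ×ˢ T | ∃ α, cc p.1 p.2 = some α ∧
    (if h : α ∈ U then κ ⟨α, h⟩ else ⟨0, hK⟩) = k}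
    (fun p hp => (mem_filter.1 hp).2.imp fun _ h => h.1)]
  push_cast
  refine sum_congr rfl fun α _ => ?_
  split_ifs with hα
  · congr 2
    ext p
    simp only [mem_filter]
    refine ⟨fun h => ⟨⟨h.1, α.1, h.2, ?_⟩, h.2⟩, fun h => ⟨h.1.1, h.2⟩⟩
    rw [dif_pos α.2]; exact hα
  · symm
    rw [Nat.cast_eq_zero, card_eq_zero, filter_eq_empty_iff]
    intro p hp hpα
    obtain ⟨-, β, hβ, hβk⟩ := mem_filter.1 hp
    rw [hpα] at hβ
    obtain rfl := Option.some.inj hβ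
    rw [dif_pos α.2] at hβk
    exact hα hβk

open Classical in
/-- In a dense pair, few vertices have small degree into a given large set. -/
theorem card_atypical_le {V : Type*} (E : V → V → Prop) {A B : Finset V} {g x : ℝ} (hx : 0 < x)
    (hE : ∀ S ⊆ A, ∀ T ⊆ B, x ≤ #S → x ≤ #T → g * #S * #T ≤ #{p ∈ S ×ˢ T | E p.1 p.2})
    {T : Finset V} (hT : T ⊆ B) (hxT : x ≤ #T) :
    (#{v ∈ A | (#{t ∈ T | E v t} : ℝ) < g * #T} : ℝ) ≤ x := by
  by_contra! hlt
  set S : Finset V := {v ∈ A | (#{t ∈ T | E v t} : ℝ) < g * #T}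
  have h1 := hE S (filter_subset _ _) T hT hlt.le hxT
  have h2 : #{p ∈ S ×ˢ T | E p.1 p.2} = ∑ v ∈ S, #{t ∈ T | E v t} := by
    simp only [card_filter]
    rw [sum_product]
  have hne : S.Nonempty := by
    rw [← card_pos]; exact_mod_cast hx.trans hlt
  have h3 : ∑ v ∈ S, (#{t ∈ T | E v t} : ℝ) < ∑ v ∈ S, g * #T :=
    sum_lt_sum_of_nonempty hne fun v hv => (mem_filter.1 hv).2
  rw [h2] at h1
  push_cast at h1
  rw [sum_const, nsmul_eq_mul] at h3
  nlinarith

/-! ### Partial embeddings and their extension by one rank -/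

/-- The pair `u v` is coloured, with a colour from the `k`-th class. -/
def InClass {V C : Type*} (cc : V → V → Option C) (κ : C → ℕ) (k : ℕ) (u v : V) : Prop :=
  ∃ α, cc u v = some α ∧ κ α = k

open Classical in
/-- The common neighbours of `u` and `v` that are joined to both by the same colour. -/
noncomputable def sameColour {V C : Type*} [Fintype V] (cc : V → V → Option C) (u v : V) :
    Finset V :=
  {t | cc u t = cc v t ∧ ∃ α, cc u t = some α}

theorem sameColour_comm {V C : Type*} [Fintype V] (cc : V → V → Option C) (u v : V) :
    sameColour cc u v = sameColour cc v u := by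
  ext t
  simp only [sameColour, mem_filter, mem_univ, true_and]
  constructor <;> rintro ⟨h, α, hα⟩
  · exact ⟨h.symm, α, h ▸ hα⟩
  · exact ⟨h.symm, α, h ▸ hα⟩

-- Double counting and Markov: for each t the colour of u t is fixed, and at most M vertices v have
-- this colour on v t, so the sizes of all sets `sameColour cc u v` sum to at most M times the
-- number of vertices.
open Classical in
theorem card_sameColour_large_le {V C : Type*} [Fintype V] (cc : V → V → Option C) {M ρ : ℝ}
    (hM : 0 ≤ M) (hρ : 0 < ρ) (hb : ∀ α, (#{p : V × V | cc p.1 p.2 = some α} : ℝ) ≤ M) (u : V) :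
    (#{v | ρ < #(sameColour cc u v)} : ℝ) ≤ Fintype.card V * M / ρ := by
  have h1 : ∀ t, (#{v | cc u t = cc v t ∧ ∃ α, cc u t = some α} : ℝ) ≤ M := by
    intro t
    by_cases h : ∃ α, cc u t = some α
    · obtain ⟨α, hα⟩ := h
      refine le_trans ?_ (hb α)
      have : #{v | cc u t = cc v t ∧ ∃ α, cc u t = some α} ≤
          #{p : V × V | cc p.1 p.2 = some α} := by
        refine card_le_card_of_injOn (fun v => (v, t)) (fun v hv => ?_)
          (fun v _ w _ hvw => (Prod.ext_iff.1 hvw).1)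
        simp only [mem_coe, mem_filter, mem_univ, true_and] at hv ⊢
        rw [← hv.1, hα]
      exact_mod_cast this
    · simp [h, hM]
  rw [le_div_iff₀ hρ]
  calc (#{v | ρ < #(sameColour cc u v)} : ℝ) * ρ
      = ∑ v with ρ < #(sameColour cc u v), ρ := by rw [sum_const, nsmul_eq_mul]
    _ ≤ ∑ v with ρ < #(sameColour cc u v), (#(sameColour cc u v) : ℝ) :=
        sum_le_sum fun v hv => (mem_filter.1 hv).2.le
    _ ≤ ∑ v, (#(sameColour cc u v) : ℝ) :=
        sum_le_sum_of_subset_of_nonneg (subset_univ _) fun _ _ _ => by positivity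
    _ = ∑ t, (#{v | cc u t = cc v t ∧ ∃ α, cc u t = some α} : ℝ) := by
        simp only [sameColour, card_filter]
        push_cast
        rw [sum_comm]
    _ ≤ ∑ t : V, M := sum_le_sum fun t _ => h1 t
    _ = _ := by rw [sum_const, nsmul_eq_mul, card_univ]

/-- `φ` is a rainbow embedding of the vertices of rank less than `s`, where edges to a vertex of
rank `k` use colours of class `k`. Each vertex `z` of rank at least `s` has a set `A z` of at least
`b` candidates. -/
structure IsPartialEmbedding {V W C : Type*} [Fintype V] (cc : V → V → Option C) (κ : C → ℕ)
    (P : W → Finset V) (H : SimpleGraph W) (q : W → ℕ) (ρ : ℝ) (s : ℕ) (b : ℝ)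
    (φ : W → V) (A : W → Finset V) : Prop where
  mem : ∀ x, q x < s → φ x ∈ P x
  inj : ∀ x x', q x < s → q x' < s → φ x = φ x' → x = x'
  -- The class is the rank of the later endpoint, so a colour determines the rank at which its edge
  -- was embedded.
  adj : ∀ x x', H.Adj x x' → q x < q x' → q x' < s → InClass cc κ (q x') (φ x) (φ x')
  rainbow : ∀ x x' z z', H.Adj x x' → H.Adj z z' → q x < q x' → q x' < s → q z < q z' →
    q z' < s → cc (φ x) (φ x') = cc (φ z) (φ z') → x = z ∧ x' = z'
  -- Needed later, at the common neighbour y: few of its candidates see the same colour from x and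
  -- x'.
  same : ∀ x x' y, x ≠ x' → H.Adj y x → H.Adj y x' → q x < s → q x' < s →
    (#(sameColour cc (φ x) (φ x')) : ℝ) ≤ ρ
  sub : ∀ z, s ≤ q z → A z ⊆ P z
  large : ∀ z, s ≤ q z → b ≤ #(A z)
  cand : ∀ z, s ≤ q z → ∀ x, H.Adj z x → q x < s → ∀ v ∈ A z, InClass cc κ (q z) (φ x) v

namespace IsPartialEmbedding

variable {V W C : Type*} [Fintype V] {cc : V → V → Option C} {κ : C → ℕ}
  {P : W → Finset V} {H : SimpleGraph W} {q : W → ℕ} {ρ : ℝ} {s : ℕ} {b : ℝ}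
  {φ : W → V} {A : W → Finset V}

-- Each such candidate lies in `sameColour` for one of at most Δ² pairs of embedded neighbours of z,
-- and the invariant `same` bounds each of these sets by ρ.
open Classical in
theorem card_repeated_le [Fintype W] (h : IsPartialEmbedding cc κ P H q ρ s b φ A)
    {Δ : ℕ} (hΔ : ∀ x, #{w | H.Adj x w} ≤ Δ) (hρ : 0 < ρ) {z : W} (hz : s ≤ q z) :
    (#{v ∈ A z | ∃ x x', H.Adj z x ∧ H.Adj z x' ∧ x ≠ x' ∧ q x < s ∧ q x' < s ∧
      cc (φ x) v = cc (φ x') v} : ℝ) ≤ Δ ^ 2 * ρ := by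
  let N : Finset (W × W) := {p ∈ ({w | H.Adj z w} : Finset W) ×ˢ ({w | H.Adj z w} : Finset W) |
    p.1 ≠ p.2 ∧ q p.1 < s ∧ q p.2 < s}
  have hN : (#N : ℝ) ≤ Δ ^ 2 := by
    have : #N ≤ Δ ^ 2 := by
      refine (card_filter_le _ _).trans ?_
      rw [card_product, sq]
      exact Nat.mul_le_mul (hΔ z) (hΔ z)
    exact_mod_cast this
  have hsub : ({v ∈ A z | ∃ x x', H.Adj z x ∧ H.Adj z x' ∧ x ≠ x' ∧ q x < s ∧ q x' < s ∧
      cc (φ x) v = cc (φ x') v} : Finset V) ⊆ N.biUnion fun p => sameColour cc (φ p.1) (φ p.2) := by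
    intro v hv
    obtain ⟨hv, x, x', hx, hx', hne, hqx, hqx', hc⟩ := mem_filter.1 hv
    obtain ⟨α, hα, -⟩ := h.cand z hz x hx hqx v hv
    simp only [mem_biUnion, N, mem_filter, mem_product, mem_univ, true_and, sameColour]
    exact ⟨(x, x'), ⟨⟨hx, hx'⟩, hne, hqx, hqx'⟩, hc, α, hα⟩
  calc _ ≤ ∑ p ∈ N, (#(sameColour cc (φ p.1) (φ p.2)) : ℝ) := by
        exact_mod_cast (card_le_card hsub).trans card_biUnion_le
    _ ≤ ∑ p ∈ N, ρ := by
        refine sum_le_sum fun p hp => ?_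
        simp only [N, mem_filter, mem_product, mem_univ, true_and] at hp
        exact h.same p.1 p.2 z hp.2.1 hp.1.1 hp.1.2 hp.2.2.1 hp.2.2.2
    _ = #N * ρ := by rw [sum_const, nsmul_eq_mul]
    _ ≤ _ := by gcongr

open Classical in
/-- `v` is a good image for `z`: it is unused, it has many neighbours in the candidate sets of the
later neighbours of `z`, and it does not create repeated colours. -/
structure IsGood (cc : V → V → Option C) (κ : C → ℕ) (H : SimpleGraph W) (q : W → ℕ) (ρ : ℝ)
    (s : ℕ) (φ : W → V) (A : W → Finset V) (g : ℝ) (z : W) (v : V) : Prop where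
  unused : ∀ x, q x < s → φ x ≠ v
  typical : ∀ w, H.Adj z w → s < q w →
    ¬ (#{t ∈ A w | InClass cc κ (q w) v t} : ℝ) < g * #(A w)
  same : ∀ y x, H.Adj z y → H.Adj y x → q x < s → ¬ ρ < #(sameColour cc (φ x) v)
  distinct : ¬ ∃ x x', H.Adj z x ∧ H.Adj z x' ∧ x ≠ x' ∧ q x < s ∧ q x' < s ∧
    cc (φ x) v = cc (φ x') v

-- The four losses are, in order: vertices already used, vertices atypical for a later neighbour of
-- z, vertices sharing too many colours with an embedded vertex reached by a walk of length two from
-- z, and candidates seeing a repeated colour.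
open Classical in
theorem le_card_good [Fintype W] (h : IsPartialEmbedding cc κ P H q ρ s b φ A)
    {Δ : ℕ} (hΔ : ∀ x, #{w | H.Adj x w} ≤ Δ) (hρ : 0 < ρ) {M g x ω : ℝ} (hM : 0 ≤ M) (hx : 0 ≤ x)
    (hb : ∀ α, (#{p : V × V | cc p.1 p.2 = some α} : ℝ) ≤ M) (hω : (Fintype.card W : ℝ) ≤ ω)
    (htyp : ∀ z w, H.Adj z w → ∀ T ⊆ P w, b ≤ #T →
      (#{v ∈ P z | (#{t ∈ T | InClass cc κ (q w) v t} : ℝ) < g * #T} : ℝ) ≤ x)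
    {z : W} (hz : s ≤ q z) :
    b - (ω + Δ * x + Δ ^ 2 * (Fintype.card V * M / ρ) + Δ ^ 2 * ρ) ≤
      #{v ∈ A z | IsGood cc κ H q ρ s φ A g z v} := by
  let N : W → Finset W := fun x => {w | H.Adj x w}
  let B₁ : Finset V := univ.image φ
  let B₂ : Finset V := ({w ∈ N z | s < q w} : Finset W).biUnion fun w =>
    {v ∈ P z | (#{t ∈ A w | InClass cc κ (q w) v t} : ℝ) < g * #(A w)}
  let B₃ : Finset V := ((N z).biUnion N).biUnion fun x => {v | ρ < #(sameColour cc (φ x) v)}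
  let B₄ : Finset V := {v ∈ A z | ∃ x x', H.Adj z x ∧ H.Adj z x' ∧ x ≠ x' ∧ q x < s ∧ q x' < s ∧
      cc (φ x) v = cc (φ x') v}
  have hN : ∀ x, #(N x) ≤ Δ := hΔ
  have h₁ : (#B₁ : ℝ) ≤ ω := by
    refine le_trans ?_ hω
    exact_mod_cast card_image_le
  have h₂ : (#B₂ : ℝ) ≤ Δ * x := by
    calc (#B₂ : ℝ) ≤ ∑ w ∈ N z with s < q w,
          (#{v ∈ P z | (#{t ∈ A w | InClass cc κ (q w) v t} : ℝ) < g * #(A w)} : ℝ) := by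
          exact_mod_cast card_biUnion_le
      _ ≤ ∑ w ∈ N z with s < q w, x := by
          refine sum_le_sum fun w hw => ?_
          simp only [N, mem_filter, mem_univ, true_and] at hw
          exact htyp z w hw.1 _ (h.sub w hw.2.le) (h.large w hw.2.le)
      _ = #({w ∈ N z | s < q w} : Finset W) * x := by rw [sum_const, nsmul_eq_mul]
      _ ≤ Δ * x := by
          gcongr
          exact_mod_cast (card_filter_le _ _).trans (hN z)
  have h₃ : (#B₃ : ℝ) ≤ Δ ^ 2 * (Fintype.card V * M / ρ) := by
    calc (#B₃ : ℝ) ≤ ∑ x ∈ (N z).biUnion N, (#{v | ρ < #(sameColour cc (φ x) v)} : ℝ) := by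
          exact_mod_cast card_biUnion_le
      _ ≤ ∑ x ∈ (N z).biUnion N, (Fintype.card V * M / ρ) :=
          sum_le_sum fun x _ => card_sameColour_large_le cc hM hρ hb (φ x)
      _ = #((N z).biUnion N) * (Fintype.card V * M / ρ) := by rw [sum_const, nsmul_eq_mul]
      _ ≤ Δ ^ 2 * (Fintype.card V * M / ρ) := by
          gcongr
          have : #((N z).biUnion N) ≤ Δ ^ 2 := by
            rw [sq]
            refine (card_biUnion_le_card_mul _ _ Δ fun x _ => hN x).trans ?_
            exact Nat.mul_le_mul_right _ (hN z)
          exact_mod_cast this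
  have h₄ : (#B₄ : ℝ) ≤ Δ ^ 2 * ρ := h.card_repeated_le hΔ hρ hz
  have hcover : A z ⊆ ({v ∈ A z | IsGood cc κ H q ρ s φ A g z v} : Finset V) ∪
      (B₁ ∪ B₂ ∪ B₃ ∪ B₄) := by
    intro v hv
    by_contra hcon
    simp only [mem_union, not_or] at hcon
    obtain ⟨h0, ⟨⟨h1, h2⟩, h3⟩, h4⟩ := hcon
    refine h0 (mem_filter.2 ⟨hv, ?_, ?_, ?_, ?_⟩)
    · rintro x - rfl
      exact h1 (mem_image_of_mem _ (mem_univ _))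
    · intro w hw hqw hlt
      refine h2 (mem_biUnion.2 ⟨w, by simp [N, hw, hqw], mem_filter.2 ⟨h.sub z hz hv, hlt⟩⟩)
    · intro y x hy hx _ hlt
      refine h3 (mem_biUnion.2 ⟨x, mem_biUnion.2 ⟨y, by simp [N, hy], by simp [N, hx]⟩, ?_⟩)
      simpa using hlt
    · intro hrep
      exact h4 (mem_filter.2 ⟨hv, hrep⟩)
  have hcard : #(A z) ≤ #{v ∈ A z | IsGood cc κ H q ρ s φ A g z v} +
      (#B₁ + #B₂ + #B₃ + #B₄) := by
    refine (card_le_card hcover).trans ((card_union_le _ _).trans ?_)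
    gcongr
    refine (card_union_le _ _).trans ?_
    gcongr
    refine (card_union_le _ _).trans ?_
    gcongr
    exact card_union_le _ _
  have hcard' : (#(A z) : ℝ) ≤ #{v ∈ A z | IsGood cc κ H q ρ s φ A g z v} +
      (#B₁ + #B₂ + #B₃ + #B₄) := by exact_mod_cast hcard
  have := h.large z hz
  linarith

open Classical in
/-- The vertices of rank `s` have good images that are pairwise distinct and use pairwise disjoint
sets of colours. -/
theorem exists_good_choice [Fintype W] (h : IsPartialEmbedding cc κ P H q ρ s b φ A)
    (hq : ∀ x x' y, q x = s → q x' = s → H.Adj y x → H.Adj y x' → x = x')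
    {Δ : ℕ} (hΔ : ∀ x, #{w | H.Adj x w} ≤ Δ) {M g m ω : ℝ} (hM : 0 ≤ M)
    (hb : ∀ α, (#{p : V × V | cc p.1 p.2 = some α} : ℝ) ≤ M) (hω : (Fintype.card W : ℝ) ≤ ω)
    (hm : 0 < m) (hm' : 4 * (ω + Δ * M) ≤ m)
    (hgood : ∀ z, q z = s → m ≤ #{v ∈ A z | IsGood cc κ H q ρ s φ A g z v}) :
    ∃ f : W → V, (∀ z, q z = s → f z ∈ A z ∧ IsGood cc κ H q ρ s φ A g z (f z)) ∧
      ∀ z z', q z = s → q z' = s → z ≠ z' → f z ≠ f z' ∧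
        ∀ x x', H.Adj x z → H.Adj x' z' → q x < s → q x' < s →
          (∃ α, cc (φ x) (f z) = some α) → cc (φ x) (f z) ≠ cc (φ x') (f z') := by
  -- The colour must exist, as otherwise two uncoloured pairs would count as a conflict.
  let r : {z // q z = s} → V → {z // q z = s} → V → Prop := fun z v z' v' => v = v' ∨
    ∃ x x', H.Adj z.1 x ∧ H.Adj z'.1 x' ∧ q x < s ∧ q x' < s ∧
      (∃ α, cc (φ x) v = some α) ∧ cc (φ x) v = cc (φ x') v'
  obtain ⟨f, hf, hf'⟩ := exists_independent_transversal (ι := {z // q z = s})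
    (fun z => {v ∈ A z.1 | IsGood cc κ H q ρ s φ A g z.1 v}) r
    (by
      rintro z v z' v' (rfl | ⟨x, x', hx, hx', hqx, hqx', ⟨α, hα⟩, hc⟩)
      · exact Or.inl rfl
      · exact Or.inr ⟨x', x, hx', hx, hqx', hqx, ⟨α, hc ▸ hα⟩, hc.symm⟩)
    hm hm' (fun z => hgood z.1 z.2)
    (by
      rintro ⟨z, hz⟩ v -
      let Q₁ : Finset ({z // q z = s} × V) := univ.image fun z' => (z', v)
      let Q : W → Finset ({z // q z = s} × V) := fun x => {p | ∃ x', H.Adj p.1.1 x' ∧ q x' < s ∧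
        (∃ α, cc (φ x) v = some α) ∧ cc (φ x) v = cc (φ x') p.2}
      have h₁ : (#Q₁ : ℝ) ≤ ω := by
        refine le_trans ?_ hω
        exact_mod_cast card_image_le.trans (Fintype.card_subtype_le _)
      have hQ : ∀ x, (#(Q x) : ℝ) ≤ M := by
        intro x
        by_cases hx : ∃ α, cc (φ x) v = some α
        · obtain ⟨α, hα⟩ := hx
          refine le_trans ?_ (hb α)
          have hmem : ∀ p : {z // q z = s} × V, p ∈ Q x →
              ∃ x', H.Adj p.1.1 x' ∧ q x' < s ∧ some α = cc (φ x') p.2 := by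
            intro p hp
            obtain ⟨x', h1, h2, -, h3⟩ := (mem_filter.1 hp).2
            exact ⟨x', h1, h2, hα ▸ h3⟩
          have : Nonempty W := ⟨z⟩
          -- A conflict (z', v') on colour α yields the pair (φ x', v') of colour α. This is
          -- injective: φ is injective on embedded vertices, and x' has at most one neighbour of
          -- rank s. So each neighbour of z causes at most M conflicts.
          choose! k hk using hmem
          have : #(Q x) ≤ #{p : V × V | cc p.1 p.2 = some α} := by
            refine card_le_card_of_injOn (fun p => (φ (k p), p.2)) ?_ ?_
            · intro p hp
              simp only [mem_coe, mem_filter, mem_univ, true_and]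
              exact (hk p hp).2.2.symm
            · intro p hp p' hp' hpp
              have h1 := h.inj _ _ (hk p hp).2.1 (hk p' hp').2.1 (Prod.ext_iff.1 hpp).1
              have h2 := hk p' hp'
              rw [← h1] at h2
              exact Prod.ext (Subtype.ext (hq _ _ _ p.1.2 p'.1.2 (hk p hp).1.symm h2.1.symm))
                (Prod.ext_iff.1 hpp).2
          exact_mod_cast this
        · have : Q x = ∅ := by
            refine filter_eq_empty_iff.2 fun p _ => ?_
            rintro ⟨_, _, _, h1, _⟩
            exact hx h1
          simpa [this] using hM
      have hsub : ({p : {z // q z = s} × V | p.1 ≠ ⟨z, hz⟩ ∧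
          p.2 ∈ ({v ∈ A p.1.1 | IsGood cc κ H q ρ s φ A g p.1.1 v} : Finset V) ∧
          r ⟨z, hz⟩ v p.1 p.2} : Finset _) ⊆
          Q₁ ∪ ({w | H.Adj z w} : Finset W).biUnion Q := by
        rintro ⟨z', v'⟩ hp
        obtain ⟨-, -, rfl | ⟨x, x', hx, hx', -, hqx', hα, hc⟩⟩ := (mem_filter.1 hp).2
        · exact mem_union_left _ (mem_image_of_mem _ (mem_univ _))
        · refine mem_union_right _ (mem_biUnion.2 ⟨x, by simpa using hx, ?_⟩)
          exact mem_filter.2 ⟨mem_univ _, x', hx', hqx', hα, hc⟩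
      have h₂ : (#(({w | H.Adj z w} : Finset W).biUnion Q) : ℝ) ≤ Δ * M := by
        calc _ ≤ ∑ w with H.Adj z w, (#(Q w) : ℝ) := by exact_mod_cast card_biUnion_le
          _ ≤ ∑ w with H.Adj z w, M := sum_le_sum fun w _ => hQ w
          _ = #({w | H.Adj z w} : Finset W) * M := by rw [sum_const, nsmul_eq_mul]
          _ ≤ Δ * M := by gcongr; exact hΔ z
      refine le_trans ?_ (add_le_add h₁ h₂)
      exact_mod_cast (card_le_card hsub).trans (card_union_le _ _))
  refine ⟨fun z => if hz : q z = s then f ⟨z, hz⟩ else φ z, fun z hz => ?_,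
    fun z z' hz hz' hne => ?_⟩
  · simp only [dif_pos hz]
    exact mem_filter.1 (hf ⟨z, hz⟩)
  · simp only [dif_pos hz, dif_pos hz']
    have h1 := hf' ⟨z, hz⟩ ⟨z', hz'⟩ (fun h => hne (Subtype.ext_iff.1 h))
    refine ⟨fun h => h1 (Or.inl h), fun x x' hx hx' hqx hqx' hα hc => ?_⟩
    exact h1 (Or.inr ⟨x, x', hx.symm, hx'.symm, hqx, hqx', hα, hc⟩)

open Classical in
/-- Good images for all vertices of rank `s` extend a partial embedding. -/
theorem extend (h : IsPartialEmbedding cc κ P H q ρ s b φ A)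
    (hq : ∀ x x' y, q x = s → q x' = s → H.Adj y x → H.Adj y x' → x = x')
    {g : ℝ} (hg : 0 ≤ g) (hg1 : g ≤ 1) {f : W → V}
    (hf : ∀ z, q z = s → f z ∈ A z ∧ IsGood cc κ H q ρ s φ A g z (f z))
    (hf' : ∀ z z', q z = s → q z' = s → z ≠ z' → f z ≠ f z' ∧
        ∀ x x', H.Adj x z → H.Adj x' z' → q x < s → q x' < s →
          (∃ α, cc (φ x) (f z) = some α) → cc (φ x) (f z) ≠ cc (φ x') (f z')) :
    IsPartialEmbedding cc κ P H q ρ (s + 1) (g * b) (fun z => if q z = s then f z else φ z)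
      (fun w => {t ∈ A w | ∀ z, H.Adj w z → q z = s → InClass cc κ (q w) (f z) t}) := by
  have hlt : ∀ {x}, q x < s → (if q x = s then f x else φ x) = φ x := fun hx => if_neg hx.ne
  have heq : ∀ {x}, q x = s → (if q x = s then f x else φ x) = f x := fun hx => if_pos hx
  have hcases : ∀ {x}, q x < s + 1 → q x < s ∨ q x = s := fun hx => by omega
  have hnew : ∀ x x', H.Adj x x' → q x < s → q x' = s → InClass cc κ (q x') (φ x) (f x') :=
    fun x x' hx hqx hqx' => h.cand x' hqx'.ge x hx.symm hqx _ (hf x' hqx').1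
  have hadj : ∀ x x', H.Adj x x' → q x < q x' → q x' < s + 1 → InClass cc κ (q x')
      (if q x = s then f x else φ x) (if q x' = s then f x' else φ x') := by
    intro x x' hx hqx hqx'
    rcases hcases hqx' with h1 | h1
    · rw [hlt h1, hlt (hqx.trans h1)]; exact h.adj x x' hx hqx h1
    · rw [hlt (h1 ▸ hqx), heq h1]; exact hnew x x' hx (h1 ▸ hqx) h1
  refine ⟨fun x hx => ?_, fun x x' hx hx' hxx => ?_, hadj, ?_, ?_, fun z hz => ?_, fun z hz => ?_,
    fun z hz x hx hqx v hv => ?_⟩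
  · rcases hcases hx with hx | hx
    · rw [hlt hx]; exact h.mem x hx
    · rw [heq hx]; exact h.sub x hx.ge (hf x hx).1
  · rcases hcases hx with hx | hx <;> rcases hcases hx' with hx' | hx'
    · rw [hlt hx, hlt hx'] at hxx; exact h.inj x x' hx hx' hxx
    · rw [hlt hx, heq hx'] at hxx; exact absurd hxx ((hf x' hx').2.unused x hx)
    · rw [heq hx, hlt hx'] at hxx; exact absurd hxx.symm ((hf x hx).2.unused x' hx')
    · rw [heq hx, heq hx'] at hxx
      by_contra hne
      exact (hf' x x' hx hx' hne).1 hxx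
  · intro x x' z z' hx hz hqx hqx' hqz hqz' hc
    obtain ⟨α, hα, hακ⟩ := hadj x x' hx hqx hqx'
    obtain ⟨β, hβ, hβκ⟩ := hadj z z' hz hqz hqz'
    have hαβ : α = β := by rw [hα, hβ] at hc; exact Option.some.inj hc
    -- Equal colours lie in one class, so both edges end in the same rank. Old ranks are covered by
    -- the invariant; in rank s, `distinct` handles a common endpoint and the transversal handles
    -- different endpoints.
    have hrank : q x' = q z' := by rw [← hακ, ← hβκ, hαβ]
    rcases hcases hqx' with h1 | h1
    · have h2 : q z' < s := hrank ▸ h1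
      rw [hlt h1, hlt (hqx.trans h1), hlt h2, hlt (hqz.trans h2)] at hc
      exact h.rainbow x x' z z' hx hz hqx h1 hqz h2 hc
    · have h2 : q z' = s := hrank ▸ h1
      have h3 : q x < s := h1 ▸ hqx
      have h4 : q z < s := h2 ▸ hqz
      rw [heq h1, heq h2, hlt h3, hlt h4] at hc
      rw [heq h1, hlt h3] at hα
      by_cases hne : x' = z'
      · subst hne
        refine ⟨?_, rfl⟩
        by_contra hxz
        exact (hf x' h1).2.distinct ⟨x, z, hx.symm, hz.symm, hxz, h3, h4, hc⟩
      · exact absurd hc ((hf' x' z' h1 h2 hne).2 x z hx hz h3 h4 ⟨α, hα⟩)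
  · intro x x' y hne hx hx' hqx hqx'
    rcases hcases hqx with h1 | h1 <;> rcases hcases hqx' with h2 | h2
    · rw [hlt h1, hlt h2]; exact h.same x x' y hne hx hx' h1 h2
    · rw [hlt h1, heq h2]; exact not_lt.1 ((hf x' h2).2.same y x hx'.symm hx h1)
    · rw [heq h1, hlt h2, sameColour_comm]
      exact not_lt.1 ((hf x h1).2.same y x' hx.symm hx' h2)
    · exact absurd (hq x x' y h1 h2 hx hx') hne
  · exact (filter_subset _ _).trans (h.sub z (by omega))
  · have hlarge := h.large z (by omega)
    -- At most one neighbour of z has rank s, so its candidates are restricted at most once, where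
    -- typicality gives the factor g.
    by_cases hz' : ∃ x, H.Adj z x ∧ q x = s
    · obtain ⟨x, hx, hqx⟩ := hz'
      have h1 := not_lt.1 ((hf x hqx).2.typical z hx.symm (by omega))
      have h2 : ({t ∈ A z | InClass cc κ (q z) (f x) t} : Finset V) ⊆
          {t ∈ A z | ∀ x, H.Adj z x → q x = s → InClass cc κ (q z) (f x) t} := by
        intro t ht
        obtain ⟨ht, ht'⟩ := mem_filter.1 ht
        refine mem_filter.2 ⟨ht, fun x' hx' hqx' => ?_⟩
        rw [hq x' x z hqx' hqx hx' hx]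
        exact ht'
      calc g * b ≤ g * #(A z) := by gcongr
        _ ≤ _ := h1
        _ ≤ _ := by exact_mod_cast card_le_card h2
    · push Not at hz'
      rw [filter_true_of_mem fun t _ x hx hqx => absurd hqx (hz' x hx)]
      nlinarith
  · obtain ⟨hv, hv'⟩ := mem_filter.1 hv
    rcases hcases hqx with h1 | h1
    · rw [hlt h1]; exact h.cand z (by omega) x hx h1 v hv
    · rw [heq h1]; exact hv' x hx h1

end IsPartialEmbedding

open Classical in
/-- All vertices of rank less than `K` can be embedded such that the remaining vertices keep
large candidate sets. -/
theorem exists_isPartialEmbedding {V W C : Type*} [Fintype V] [Fintype W] [Nonempty V]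
    {cc : V → V → Option C} {κ : C → ℕ} {P : W → Finset V} {H : SimpleGraph W} {q : W → ℕ}
    {K Δ : ℕ} {ρ b M g x ω : ℝ}
    (hq : ∀ x x' y, q x = q x' → q x < K → H.Adj y x → H.Adj y x' → x = x')
    (hΔ : ∀ x, #{w | H.Adj x w} ≤ Δ) (hρ : 0 < ρ) (hM : 0 ≤ M) (hx : 0 ≤ x)
    (hb0 : 0 < b) (hg : 0 < g) (hg1 : g ≤ 1)
    (hb : ∀ α, (#{p : V × V | cc p.1 p.2 = some α} : ℝ) ≤ M) (hω : (Fintype.card W : ℝ) ≤ ω)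
    (hP : ∀ z, b ≤ #(P z))
    (htyp : ∀ z w, H.Adj z w → ∀ T ⊆ P w, g ^ K * b ≤ #T →
      (#{v ∈ P z | (#{t ∈ T | InClass cc κ (q w) v t} : ℝ) < g * #T} : ℝ) ≤ x)
    (hsmall : ω + Δ * x + Δ ^ 2 * (Fintype.card V * M / ρ) + Δ ^ 2 * ρ ≤ g ^ K * b / 2)
    (hconf : 4 * (ω + Δ * M) ≤ g ^ K * b / 2) :
    ∃ φ A, IsPartialEmbedding cc κ P H q ρ K (g ^ K * b) φ A := by
  suffices H' : ∀ s ≤ K, ∃ φ A, IsPartialEmbedding cc κ P H q ρ s (g ^ s * b) φ A from H' K le_rfl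
  intro s
  induction s with
  | zero =>
    intro _
    refine ⟨fun _ => Classical.arbitrary V, P, ?_⟩
    constructor <;> simp [hP]
  | succ s ih =>
    intro hs
    obtain ⟨φ, A, h⟩ := ih (by omega)
    have hpow : g ^ K * b ≤ g ^ s * b :=
      mul_le_mul_of_nonneg_right (pow_le_pow_of_le_one hg.le hg1 (by omega)) hb0.le
    have hq' : ∀ x x' y, q x = s → q x' = s → H.Adj y x → H.Adj y x' → x = x' :=
      fun x x' y h1 h2 => hq x x' y (h1.trans h2.symm) (by omega)
    -- The candidate sets never drop below g ^ K * b, and the losses cost at most half of that.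
    have hgood : ∀ z, q z = s → g ^ K * b / 2 ≤
        #{v ∈ A z | IsPartialEmbedding.IsGood cc κ H q ρ s φ A g z v} := by
      intro z hz
      have := h.le_card_good hΔ hρ (g := g) hM hx hb hω
        (fun z w hzw T hT hbT => htyp z w hzw T hT (hpow.trans hbT)) hz.ge
      linarith
    obtain ⟨f, hf, hf'⟩ := h.exists_good_choice hq' hΔ hM hb hω (by positivity) hconf hgood
    have h' := h.extend hq' hg.le hg1 hf hf'
    rw [← mul_assoc, ← pow_succ'] at h'
    exact ⟨_, _, h'⟩

/-! ### From edge colourings and regular pairs to partial embeddings -/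

open Classical in
/-- The colour of the pair `u v`, if it is an edge. -/
noncomputable def colourOf {V C : Type*} {G : SimpleGraph V} (c : G.EdgeLabeling C) (u v : V) :
    Option C :=
  if h : G.Adj u v then some (c.get u v h) else none

theorem colourOf_of_adj {V C : Type*} {G : SimpleGraph V} (c : G.EdgeLabeling C) {u v : V}
    (h : G.Adj u v) : colourOf c u v = some (c.get u v h) :=
  dif_pos h

theorem colourOf_eq_some {V C : Type*} {G : SimpleGraph V} {c : G.EdgeLabeling C} {u v : V}
    {α : C} : colourOf c u v = some α ↔ ∃ h : G.Adj u v, c.get u v h = α := by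
  unfold colourOf
  split_ifs with h
  · simp [h]
  · simp [h]

-- The factor 2 arises because each edge gives two ordered pairs.
open Classical in
theorem IsBoundedColouring.card_pairs_le {V C : Type*} [Fintype V] {G : SimpleGraph V}
    {c : G.EdgeLabeling C} {k : ℝ} (h : IsBoundedColouring c k) (α : C) :
    (#{p : V × V | colourOf c p.1 p.2 = some α} : ℝ) ≤ 2 * k := by
  set Q : Finset (V × V) := {p | colourOf c p.1 p.2 = some α}
  have h1 : #Q ≤ 2 * #(Q.image fun p => s(p.1, p.2)) := by
    refine card_le_mul_card_image _ 2 fun e he => ?_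
    obtain ⟨p, -, rfl⟩ := mem_image.1 he
    refine (card_le_card (t := {p, p.swap}) fun p' hp' => ?_).trans card_le_two
    have h2 := (mem_filter.1 hp').2
    rw [Sym2.eq_iff] at h2
    simp only [mem_insert, mem_singleton]
    exact h2.imp (fun h => Prod.ext h.1 h.2) (fun h => Prod.ext h.1 h.2)
  have h2 : #(Q.image fun p => s(p.1, p.2)) ≤ {e : G.edgeSet | c e = α}.ncard := by
    have h3 : ((Q.image fun p => s(p.1, p.2) : Finset (Sym2 V)) : Set (Sym2 V)) ⊆
        Subtype.val '' {e : G.edgeSet | c e = α} := by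
      intro e he
      obtain ⟨p, hp, rfl⟩ := mem_image.1 (mem_coe.1 he)
      obtain ⟨hadj, hc⟩ := colourOf_eq_some.1 (mem_filter.1 hp).2
      exact ⟨⟨s(p.1, p.2), hadj⟩, hc, rfl⟩
    rw [← Set.ncard_coe_finset]
    exact (Set.ncard_le_ncard h3 (Set.toFinite _)).trans (Set.ncard_image_le (Set.toFinite _))
  have h3 : (#Q : ℝ) ≤ 2 * ({e : G.edgeSet | c e = α}.ncard : ℝ) := by
    exact_mod_cast h1.trans (Nat.mul_le_mul_left 2 h2)
  linarith [h α]

open Classical in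
/-- In a lower regular pair, a colour class that contains almost its fair share of the edges
between any two sets spans a dense pair. -/
theorem IsLowerRegular.colour_class_dense {V C : Type*} [Fintype V] {G : SimpleGraph V}
    [DecidableRel G.Adj] {c : G.EdgeLabeling C} {ε d η N : ℝ} {A B : Finset V}
    (h : IsLowerRegular G ε d A B) (hε : ε ≤ d / 2) (hε0 : 0 ≤ ε) (hεη : 2 * ε ≤ η)
    (hη : 0 < η) (hN : 0 < N) (hA : (#A : ℝ) ≤ 2 * N) (hB : (#B : ℝ) ≤ 2 * N)
    {E : V → V → Prop} {K : ℝ} (hK : 0 < K) (hd : 0 ≤ d)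
    (hE : ∀ S T : Finset V, (#{p ∈ S ×ˢ T | ∃ α, colourOf c p.1 p.2 = some α} : ℝ) / K -
      d / (4 * K) * (η * N) ^ 2 ≤ #{p ∈ S ×ˢ T | E p.1 p.2})
    (S : Finset V) (hS : S ⊆ A) (T : Finset V) (hT : T ⊆ B) (hSc : η * N ≤ #S)
    (hTc : η * N ≤ #T) :
    d / (4 * K) * #S * #T ≤ #{p ∈ S ×ˢ T | E p.1 p.2} := by
  have hηN : 0 < η * N := mul_pos hη hN
  have h1 := h S hS T hT (by nlinarith) (by nlinarith)
  have h2 : ({p ∈ S ×ˢ T | ∃ α, colourOf c p.1 p.2 = some α} : Finset (V × V)) =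
      G.interedges S T := by
    ext p
    simp only [mem_filter, mem_product, SimpleGraph.mem_interedges_iff, colourOf_eq_some]
    constructor
    · rintro ⟨⟨h1, h2⟩, α, h3, -⟩; exact ⟨h1, h2, h3⟩
    · rintro ⟨h1, h2, h3⟩; exact ⟨⟨h1, h2⟩, _, h3, rfl⟩
  have h3 := hE S T
  rw [h2] at h3
  have hST : 0 < (#S : ℝ) * #T := mul_pos (hηN.trans_le hSc) (hηN.trans_le hTc)
  have h4 : d / 2 * (#S * #T : ℝ) ≤ #(G.interedges S T) := by
    rw [SimpleGraph.edgeDensity_def] at h1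
    push_cast at h1
    rw [le_div_iff₀ hST] at h1
    nlinarith
  -- The class has a fair share of at least d / (2K) * |S||T|. As |S| and |T| are at least ηN, the
  -- splitting error takes away at most half of it.
  have h5 : (η * N) ^ 2 ≤ #S * #T := by
    rw [sq]; exact mul_le_mul hSc hTc hηN.le (hηN.le.trans hSc)
  have h6 : d / 2 * (#S * #T : ℝ) / K ≤ #(G.interedges S T) / K := by gcongr
  have h7 : d / (4 * K) * (η * N) ^ 2 ≤ d / (4 * K) * (#S * #T) := by gcongr
  have h8 : d / 2 * (#S * #T : ℝ) / K = 2 * (d / (4 * K) * (#S * #T)) := by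
    field_simp; ring
  rw [mul_assoc]
  linarith

open Classical in
/-- A set of vertices of a graph of bounded degree can be ranked by boundedly many numbers such that
adjacent vertices and vertices with a common neighbour have different ranks; the vertices outside
the set get the next rank. -/
theorem exists_rank {W : Type*} [Fintype W] (H : SimpleGraph W) {Δ : ℕ}
    (hΔ : ∀ x, #{w | H.Adj x w} ≤ Δ) (X : Set W) :
    ∃ q : W → ℕ, (∀ x ∈ X, q x < Δ + Δ ^ 2 + 1) ∧ (∀ x ∉ X, q x = Δ + Δ ^ 2 + 1) ∧
      (∀ x ∈ X, ∀ x' ∈ X, H.Adj x x' → q x ≠ q x') ∧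
      ∀ x x' y, q x = q x' → q x < Δ + Δ ^ 2 + 1 → H.Adj y x → H.Adj y x' → x = x' := by
  obtain ⟨q, h1, h2⟩ := exists_greedy_colouring
    -- Paths of length two through vertices outside X count as well, so that every vertex, including
    -- those of Y, has at most one neighbour in each rank of X.
    (fun x x' => H.Adj x x' ∨ ∃ y, H.Adj x y ∧ H.Adj y x') (D := Δ + Δ ^ 2)
    (fun x x' h => h.imp (fun h => h.symm) fun ⟨y, h, h'⟩ => ⟨y, h'.symm, h.symm⟩)
    (fun x => by
      have hcard : #(({y | H.Adj x y} : Finset W).biUnion fun y => ({w | H.Adj y w} : Finset W)) ≤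
          Δ ^ 2 := by
        rw [sq]
        exact (card_biUnion_le_card_mul _ _ Δ fun y _ => hΔ y).trans
          (Nat.mul_le_mul_right _ (hΔ x))
      refine (card_le_card (t := ({w | H.Adj x w} : Finset W) ∪
        ({y | H.Adj x y} : Finset W).biUnion fun y => ({w | H.Adj y w} : Finset W))
        fun w hw => ?_).trans ((card_union_le _ _).trans (add_le_add (hΔ x) hcard))
      simpa using hw)
  let q' : W → ℕ := fun x => if x ∈ X then q x else Δ + Δ ^ 2 + 1
  have hpos : ∀ x ∈ X, q' x = q x := fun x hx => if_pos hx
  have hneg : ∀ x ∉ X, q' x = Δ + Δ ^ 2 + 1 := fun x hx => if_neg hx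
  refine ⟨q', fun x hx => (hpos x hx).trans_lt (h1 x), hneg,
    fun x hx x' hx' hadj => ?_, fun x x' y hqq hqx hx hx' => ?_⟩
  · rw [hpos x hx, hpos x' hx']
    exact h2 x x' hadj.ne (Or.inl hadj)
  · have hmem : ∀ x, q' x < Δ + Δ ^ 2 + 1 → x ∈ X := fun x hx => by
      by_contra h
      exact hx.ne (hneg x h)
    by_contra hne
    have hxX' := hmem x' (hqq.symm.trans_lt hqx)
    rw [hpos x (hmem x hqx), hpos x' hxX'] at hqq
    exact h2 x x' hne (Or.inr ⟨y, hx.symm, hx'⟩) hqq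

open Classical in
/-- A partial embedding whose unembedded vertices are those of rank `K` yields a rainbow
embedding of `H[X]` that avoids the colours of class `K`. -/
theorem IsPartialEmbedding.exists_copy {V W C : Type*} [Fintype V] {G : SimpleGraph V}
    {c : G.EdgeLabeling C} {κ : C → ℕ} {P : W → Finset V} {H : SimpleGraph W} {q : W → ℕ}
    {ρ b : ℝ} {K : ℕ} {φ : W → V} {A : W → Finset V}
    (h : IsPartialEmbedding (colourOf c) κ P H q ρ K b φ A) {X : Set W}
    (hX : ∀ x ∈ X, q x < K) (hadj : ∀ x ∈ X, ∀ x' ∈ X, H.Adj x x' → q x ≠ q x') :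
    ∃ ψ : (H.induce X).Copy (colourSubgraph c {α | κ α = K}ᶜ), (∀ x, ψ x = φ x) ∧
      IsRainbow c ((SimpleGraph.Hom.ofLE (colourSubgraph_le c {α | κ α = K}ᶜ)).comp ψ.toHom) := by
  have hlt : ∀ x x' : X, H.Adj x x' → q x < q x' →
      (colourSubgraph c {α | κ α = K}ᶜ).Adj (φ x) (φ x') := by
    intro x x' hxx hq
    obtain ⟨α, hα, hακ⟩ := h.adj x x' hxx hq (hX _ x'.2)
    obtain ⟨h1, rfl⟩ := colourOf_eq_some.1 hα
    exact ⟨h1, fun h2 => (hX _ x'.2).ne (hακ ▸ h2)⟩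
  let f : H.induce X →g colourSubgraph c {α | κ α = K}ᶜ :=
    { toFun := fun x => φ x
      map_rel' := by
        intro x x' hxx
        have hxx' : H.Adj x x' := hxx
        rcases lt_or_gt_of_ne (hadj x x.2 x' x'.2 hxx') with hq | hq
        · exact hlt x x' hxx' hq
        · exact (hlt x' x hxx'.symm hq).symm }
  have hinj : Function.Injective f := fun x x' hxx =>
    Subtype.ext (h.inj x x' (hX _ x.2) (hX _ x'.2) hxx)
  refine ⟨f.toCopy hinj, fun x => rfl, ?_⟩
  -- Orienting each edge towards the higher rank makes its representation unique, as the field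
  -- `rainbow` requires.
  have hrep : ∀ e : (H.induce X).edgeSet, ∃ x x' : X, e.1 = s(x, x') ∧ H.Adj x x' ∧
      q x < q x' := by
    rintro ⟨e, he⟩
    induction e using Sym2.inductionOn with
    | hf x x' =>
      have hxx : H.Adj x x' := he
      rcases lt_or_gt_of_ne (hadj x x.2 x' x'.2 hxx) with hq | hq
      · exact ⟨x, x', rfl, hxx, hq⟩
      · exact ⟨x', x, Sym2.eq_swap, hxx.symm, hq⟩
  rintro ⟨e, he⟩ ⟨e', he'⟩ hee
  obtain ⟨x, x', hx, hxx, hq⟩ := hrep ⟨e, he⟩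
  obtain ⟨z, z', hz, hzz, hq'⟩ := hrep ⟨e', he'⟩
  simp only at hx hz
  subst hx hz
  have h1 : G.Adj (φ x) (φ x') := (hlt x x' hxx hq).1
  have h2 : G.Adj (φ z) (φ z') := (hlt z z' hzz hq').1
  have h3 : c.get (φ x) (φ x') h1 = c.get (φ z) (φ z') h2 := hee
  have h4 := h.rainbow x x' z z' hxx hzz hq (hX _ x'.2) hq' (hX _ z'.2)
    (by rw [colourOf_of_adj c h1, colourOf_of_adj c h2, h3])
  obtain rfl : x = z := Subtype.ext h4.1
  obtain rfl : x' = z' := Subtype.ext h4.2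
  rfl

open Classical in
/-- Every vertex that is not yet embedded has many candidates that are joined to its embedded
neighbours by edges of pairwise different colours. -/
theorem IsPartialEmbedding.exists_distinct_candidates {V W C : Type*} [Fintype V] [Fintype W]
    {cc : V → V → Option C} {κ : C → ℕ} {P : W → Finset V} {H : SimpleGraph W} {q : W → ℕ}
    {ρ b : ℝ} {s : ℕ} {φ : W → V} {A : W → Finset V}
    (h : IsPartialEmbedding cc κ P H q ρ s b φ A) {Δ : ℕ} (hΔ : ∀ x, #{w | H.Adj x w} ≤ Δ)
    (hρ : 0 < ρ) {z : W} (hz : s ≤ q z) :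
    ∃ S ⊆ A z, b - Δ ^ 2 * ρ ≤ #S ∧ ∀ x x', H.Adj z x → H.Adj z x' → x ≠ x' → q x < s →
      q x' < s → ∀ v ∈ S, cc (φ x) v ≠ cc (φ x') v := by
  have h1 := h.card_repeated_le hΔ hρ hz
  set B : Finset V := {v ∈ A z | ∃ x x', H.Adj z x ∧ H.Adj z x' ∧ x ≠ x' ∧ q x < s ∧ q x' < s ∧
      cc (φ x) v = cc (φ x') v}
  refine ⟨A z \ B, sdiff_subset, ?_, fun x x' hx hx' hne hqx hqx' v hv hcol => ?_⟩
  · have h2 : (#(A z) : ℝ) ≤ #(A z \ B) + #B := by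
      exact_mod_cast card_le_card_sdiff_add_card
    linarith [h.large z hz]
  · obtain ⟨hvA, hvB⟩ := mem_sdiff.1 hv
    exact hvB (mem_filter.2 ⟨hvA, x, x', hx, hx', hne, hqx, hqx', hcol⟩)

open Classical in
/-- The sizes involved in embedding one rank after the other are compatible with the choice of
the constants. -/
theorem exists_isPartialEmbedding_of_lowerRegular {d ε μ : ℝ} {Δ K r : ℕ} (hd0 : 0 < d)
    (hd1 : d ≤ 1) (hΔ : 1 ≤ Δ) (hr : 1 ≤ r) {g β δ : ℝ}
    (hg : g = d / (4 * ((K + 1 : ℕ) : ℝ))) (hβ : β = g ^ K)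
    (hδ : δ = g * (β / (16 * Δ)) ^ 2 / (r : ℝ) ^ 2)
    (hε0 : 0 < ε) (hε : ε ≤ β * d / (64 * Δ)) (hμ0 : 0 < μ)
    (hμ1 : μ ≤ β ^ 2 / (1024 * Δ ^ 4 * r ^ 2)) (hμ2 : μ ≤ β / (64 * Δ * r))
    (hμ3 : 8 * (((K + 1 : ℕ) : ℝ) + 3) * μ ≤ ((K + 1 : ℕ) : ℝ) * δ ^ 2)
    {R : SimpleGraph (Fin r)} {V W C : Type*} [Fintype V] [Fintype W] [Nonempty V]
    {G : SimpleGraph V} [DecidableRel G.Adj] {P : Fin r → Finset V} {H : SimpleGraph W}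
    {c : G.EdgeLabeling C}
    (hreg : ∀ i j, R.Adj i j → IsLowerRegular G ε d (P i) (P j))
    (hP : ∀ i, (1 - ε) * ((Fintype.card V : ℝ) / r) ≤ #(P i) ∧
      (#(P i) : ℝ) ≤ (1 + ε) * ((Fintype.card V : ℝ) / r))
    (hW : (Fintype.card W : ℝ) ≤ ε * Fintype.card V / r)
    (hdeg : ∀ x, #{w | H.Adj x w} ≤ Δ)
    (hc : IsBoundedColouring c (μ * Fintype.card V))
    {part : W → Fin r} (hpart : ∀ z w, H.Adj z w → R.Adj (part z) (part w))
    {q : W → ℕ} (hqK : ∀ x, q x ≤ K)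
    (hq : ∀ x x' y, q x = q x' → q x < K → H.Adj y x → H.Adj y x' → x = x') :
    ∃ (κ : C → ℕ) (ρ : ℝ) (φ : W → V) (A : W → Finset V), 0 < ρ ∧
      IsPartialEmbedding (colourOf c) κ (fun w => P (part w)) H q ρ K
        (β / 2 * ((Fintype.card V : ℝ) / r)) φ A ∧
      Δ ^ 2 * ρ ≤ β / 4 * ((Fintype.card V : ℝ) / r) := by
  set n := Fintype.card V with hn_def
  have hn : 0 < n := Fintype.card_pos
  have hn0 : (0 : ℝ) < n := by exact_mod_cast hn
  have hr0 : (0 : ℝ) < r := by exact_mod_cast hr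
  have hΔ1 : (1 : ℝ) ≤ Δ := by exact_mod_cast hΔ
  have hΔ0 : (0 : ℝ) < Δ := by linarith
  have hK1 : (1 : ℝ) ≤ ((K + 1 : ℕ) : ℝ) := by push_cast; linarith [(Nat.cast_nonneg K : (0:ℝ) ≤ K)]
  have hg0 : 0 < g := by rw [hg]; positivity
  have hg1 : g ≤ 1 := by
    rw [hg, div_le_one (by positivity)]; linarith
  have hβ0 : 0 < β := by rw [hβ]; positivity
  have hβ1 : β ≤ 1 := by rw [hβ]; exact pow_le_one₀ hg0.le hg1
  set N : ℝ := (n : ℝ) / r with hN_def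
  have hN : 0 < N := div_pos hn0 hr0
  have hnN : (n : ℝ) = N * r := by rw [hN_def]; field_simp
  -- Sets smaller than ηN are negligible: atypical vertices for up to Δ neighbours cost Δ η N = βN /
  -- 16. The value of δ makes the splitting error δn² equal to g(ηN)².
  set η : ℝ := β / (16 * Δ) with hη_def
  have hη0 : 0 < η := by positivity
  have hηβ : Δ * η = β / 16 := by rw [hη_def]; field_simp
  have hε1 : ε * (64 * Δ) ≤ β * d := (le_div_iff₀ (by positivity)).1 hε
  have hβd : β * d ≤ β := mul_le_of_le_one_right hβ0.le hd1
  have hβd' : β * d ≤ d := mul_le_of_le_one_left hd0.le hβ1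
  have hεΔ : ε ≤ ε * Δ := le_mul_of_one_le_right hε0.le hΔ1
  have hεd : ε ≤ d / 2 := by linarith
  have hεβ : ε ≤ β / 64 := by linarith
  have hεη : 2 * ε ≤ η := by
    rw [hη_def, le_div_iff₀ (by positivity)]; linarith
  have hb := fun α => hc.card_pairs_le α
  have hb' : ∀ α, (#{p : V × V | colourOf c p.1 p.2 = some α} : ℝ) ≤ 2 * μ * n :=
    fun α => (hb α).trans_eq (by ring)
  have hδ0 : 0 < δ := by rw [hδ]; positivity
  obtain ⟨κ, hκ⟩ := exists_colour_classes (colourOf c) (Nat.succ_pos K) hμ0 hδ0 hμ3 hn hb'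
  have hδn : δ * (n : ℝ) ^ 2 = d / (4 * ((K + 1 : ℕ) : ℝ)) * (η * N) ^ 2 := by
    rw [hδ, ← hg, hnN]; field_simp
  have hPle : ∀ i, (#(P i) : ℝ) ≤ 2 * N := fun i =>
    (hP i).2.trans (mul_le_mul_of_nonneg_right (by linarith) hN.le)
  have hηle : η * N ≤ g ^ K * (N / 2) := by
    have h1 : η ≤ Δ * η := le_mul_of_one_le_left hη0.le hΔ1
    have h2 : η * N ≤ β / 2 * N := mul_le_mul_of_nonneg_right (by linarith) hN.le
    rw [← hβ]; linarith
  -- The value of ρ balances two losses: Δ²ρ = βN / 32 for repeated colours, and at most βN / 16 for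
  -- large `sameColour` sets by the first bound on μ. With εN ≤ βN / 64 and βN / 16 for atypical
  -- vertices, the total stays below βN / 4, half of the final size βN / 2.
  have hρ : 0 < β * N / (32 * Δ ^ 2) := by positivity
  have hωe : ε * n / r = ε * N := by rw [hN_def]; ring
  have hρ' : (Δ : ℝ) ^ 2 * (β * N / (32 * Δ ^ 2)) = β * N / 32 := by field_simp
  have hμr : μ * (64 * Δ * r) ≤ β := (le_div_iff₀ (by positivity)).1 hμ2
  have hμr' : μ * (1024 * Δ ^ 4 * r ^ 2) ≤ β ^ 2 := (le_div_iff₀ (by positivity)).1 hμ1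
  have hcodeg : (Δ : ℝ) ^ 2 * (n * (2 * μ * n) / (β * N / (32 * Δ ^ 2))) ≤ β * N / 16 := by
    have h1 : (Δ : ℝ) ^ 2 * (n * (2 * μ * n) / (β * N / (32 * Δ ^ 2))) =
        μ * (1024 * Δ ^ 4 * r ^ 2) * N / (16 * β) := by
      rw [hnN]; field_simp; norm_num
    rw [h1, div_le_iff₀ (by positivity)]
    have h2 := mul_le_mul_of_nonneg_right hμr' hN.le
    linarith
  have hβN : 0 < β * N := mul_pos hβ0 hN
  have hεN : ε * N ≤ β / 64 * N := mul_le_mul_of_nonneg_right hεβ hN.le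
  obtain ⟨φ, A, h⟩ := exists_isPartialEmbedding (cc := colourOf c) (κ := fun α => (κ α : ℕ))
    (P := fun w => P (part w)) (H := H) (q := q) (K := K) (b := N / 2) (M := 2 * μ * n)
    (x := η * N) (ω := ε * n / r) (g := g) hq hdeg hρ (by positivity) (by positivity)
    (by positivity) hg0 hg1 hb' hW
    (fun z => le_trans (by
      have h1 : β / 64 * N ≤ 1 / 2 * N := mul_le_mul_of_nonneg_right (by linarith) hN.le
      linarith) (hP (part z)).1)
    (by
      intro z w hzw T hT hTc
      refine card_atypical_le _ (by positivity) ?_ hT (hηle.trans hTc)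
      intro S hS T hT hSc hTc
      rw [hg]
      refine (hreg _ _ (hpart z w hzw)).colour_class_dense (c := c) hεd hε0.le hεη hη0 hN (hPle _) (hPle _)
        (by positivity) hd0.le ?_ S hS T hT hSc hTc
      intro S T
      have h1 := hκ S T ⟨q w, Nat.lt_succ_of_le (hqK w)⟩
      rw [← hn_def, hδn] at h1
      refine h1.trans (Nat.cast_le.2 (card_le_card fun p hp => ?_))
      obtain ⟨hp, α, hα, hακ⟩ := mem_filter.1 hp
      exact mem_filter.2 ⟨hp, α, hα, congrArg Fin.val hακ⟩)
    (by
      rw [hρ', ← hβ, hωe]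
      have h1 : Δ * (η * N) = β / 16 * N := by rw [← mul_assoc, hηβ]
      rw [h1]
      linarith)
    (by
      rw [hωe, ← hβ, hnN]
      have h1 : Δ * (2 * μ * (N * r)) = μ * (64 * Δ * r) * N / 32 := by ring
      have h2 := mul_le_mul_of_nonneg_right hμr hN.le
      rw [h1]
      linarith)
  refine ⟨fun α => (κ α : ℕ), _, φ, A, hρ, ?_, ?_⟩
  · rw [← hβ] at h
    convert h using 1
    ring
  · rw [hρ']; linarith

end RainbowEmbedding

/-! ### Choice of constants and the main theorem -/

theorem lemma6p4 (d : ℝ) (hd0 : 0 < d) (hd1 : d ≤ 1) (Δ : ℕ) (hΔ : 1 ≤ Δ) :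
    ∃ d₀ : ℝ, 0 < d₀ ∧ ∀ d' : ℝ, 0 < d' → d' ≤ d₀ →
    ∃ ε₀ : ℝ, 0 < ε₀ ∧ ∀ r : ℕ, 1 ≤ r →
    ∃ μ₀ : ℝ, 0 < μ₀ ∧ ∀ ε μ : ℝ, 0 < ε → ε ≤ ε₀ → 0 < μ → μ ≤ μ₀ →
    ∃ n₀ : ℕ, ∀ n : ℕ, n₀ ≤ n →
    ∀ (R : SimpleGraph (Fin r))
      (V : Type u) [Fintype V] (G : SimpleGraph V) [DecidableRel G.Adj] (P : Fin r → Finset V)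
      (W : Type v) [Fintype W] (H : SimpleGraph W) [DecidableRel H.Adj] (X Y : Fin r → Set W)
      (C : Type w) (c : G.EdgeLabeling C),
      Fintype.card V = n →
      RainbowEmbedding.IsVertexPartition (fun i => (P i : Set V)) →
      (∀ i j, R.Adj i j → RainbowEmbedding.IsLowerRegular G ε d (P i) (P j)) →
      (∀ i, (1 - ε) * ((n : ℝ) / r) ≤ ((P i).card : ℝ) ∧
        ((P i).card : ℝ) ≤ (1 + ε) * ((n : ℝ) / r)) →
      (Fintype.card W : ℝ) ≤ ε * n / r →
      RainbowEmbedding.IsVertexPartition (Sum.elim X Y) →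
      H.maxDegree ≤ Δ →
      (∀ i, H.IsIndepSet (X i ∪ Y i)) →
      (∀ i j, ∀ z ∈ X i ∪ Y i, ∀ z' ∈ X j ∪ Y j, H.Adj z z' → R.Adj i j) →
      RainbowEmbedding.IsBoundedColouring c (μ * n) →
      ∃ (C' : Set C)
        (φ : (H.induce (⋃ i, X i)).Copy (RainbowEmbedding.colourSubgraph c C'ᶜ))
        (S : W → Finset V),
        RainbowEmbedding.IsRainbow c
          ((SimpleGraph.Hom.ofLE (RainbowEmbedding.colourSubgraph_le c C'ᶜ)).comp φ.toHom) ∧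
        (∀ i, ∀ y ∈ Y i, S y ⊆ P i) ∧
        (∀ i, ∀ x : ↥(⋃ j, X j), (x : W) ∈ X i → φ x ∈ P i) ∧
        (∀ y ∈ ⋃ i, Y i, d' * n / r ≤ ((S y).card : ℝ) ∧
          ∀ x : ↥(⋃ j, X j), H.Adj y x →
            ∀ v ∈ S y, (RainbowEmbedding.colourSubgraph c C').Adj (φ x) v) ∧
        (∀ y ∈ ⋃ i, Y i, ∀ x x' : ↥(⋃ j, X j), x ≠ x' → H.Adj y x → H.Adj y x' →
          ∀ v ∈ S y, ∀ (h : G.Adj (φ x) v) (h' : G.Adj (φ x') v),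
            c.get (φ x) v h ≠ c.get (φ x') v h') := by
  classical
  set K : ℕ := Δ + Δ ^ 2 + 1 with hK
  set g : ℝ := d / (4 * ((K + 1 : ℕ) : ℝ)) with hg
  set β : ℝ := g ^ K with hβ
  have hΔ0 : (0 : ℝ) < Δ := by exact_mod_cast hΔ
  have hg0 : 0 < g := by positivity
  have hβ0 : 0 < β := by positivity
  -- Final candidate sets have size at least βN / 2 with N = n / r; removing repeated colours costs
  -- at most βN / 4, which leaves d₀ = β / 4. Neither β nor ε₀ depends on r.
  refine ⟨β / 4, by positivity, fun d' _ hd' => ⟨β * d / (64 * Δ), by positivity, fun r hr => ?_⟩⟩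
  have hr0 : (0 : ℝ) < r := by exact_mod_cast hr
  set δ : ℝ := g * (β / (16 * Δ)) ^ 2 / (r : ℝ) ^ 2 with hδ
  have hδ0 : 0 < δ := by positivity
  -- The three bounds on μ serve the `sameColour` sets, the conflicts within a rank, and the colour
  -- splitting. All estimates hold for every n ≥ 1, so n₀ = 1 suffices.
  refine ⟨min (β ^ 2 / (1024 * Δ ^ 4 * r ^ 2)) (min (β / (64 * Δ * r))
    (((K + 1 : ℕ) : ℝ) * δ ^ 2 / (8 * (((K + 1 : ℕ) : ℝ) + 3)))), by positivity,
    fun ε μ hε0 hε hμ0 hμ => ⟨1, fun n hn => ?_⟩⟩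
  intro R V _ G _ P W _ H _ X Y C c hcard hPpart hreg hP hW hXY hdeg hind hR hc
  obtain ⟨hμ1, hμ⟩ := le_min_iff.1 hμ
  obtain ⟨hμ2, hμ3⟩ := le_min_iff.1 hμ
  rw [le_div_iff₀ (by positivity)] at hμ3
  subst hcard
  have : Nonempty V := Fintype.card_pos_iff.1 hn
  have hdeg' : ∀ x, (@Finset.filter W (fun w => H.Adj x w)
      (fun w => Classical.propDecidable (H.Adj x w)) Finset.univ).card ≤ Δ := by
    intro x
    refine le_trans (le_of_eq ?_) ((H.degree_le_maxDegree x).trans hdeg)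
    rw [← SimpleGraph.card_neighborFinset_eq_degree, SimpleGraph.neighborFinset_eq_filter]
    congr
  choose side hside huniq using hXY
  let part : W → Fin r := fun w => (side w).elim id id
  have hpart : ∀ w, w ∈ X (part w) ∪ Y (part w) := by
    intro w
    have h : ∀ s, w ∈ Sum.elim X Y s → w ∈ X (s.elim id id) ∪ Y (s.elim id id) := by
      rintro (i | i) hi
      · exact Or.inl hi
      · exact Or.inr hi
    exact h _ (hside w)
  have hpartX : ∀ i, ∀ x ∈ X i, part x = i := by
    intro i x hx
    have h := huniq x (Sum.inl i) hx
    simp only [part, ← h, Sum.elim_inl, id]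
  have hpartY : ∀ i, ∀ y ∈ Y i, part y = i ∧ y ∉ ⋃ j, X j := by
    intro i y hy
    have h := huniq y (Sum.inr i) hy
    refine ⟨by simp only [part, ← h, Sum.elim_inr, id], fun hyX => ?_⟩
    obtain ⟨j, hj⟩ := Set.mem_iUnion.1 hyX
    have h' := huniq y (Sum.inl j) hj
    rw [← h] at h'
    exact absurd h' (by simp)
  obtain ⟨q, hqX, hqY, hqadj, hq⟩ := RainbowEmbedding.exists_rank H hdeg' (⋃ i, X i)
  have hqK : ∀ x, q x ≤ K := by
    intro x
    by_cases hx : x ∈ ⋃ i, X i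
    · exact (hqX x hx).le
    · exact (hqY x hx).le
  obtain ⟨κ, ρ, φ, A, hρ, h, hrep⟩ :=
    RainbowEmbedding.exists_isPartialEmbedding_of_lowerRegular (K := K) hd0 hd1 hΔ hr hg hβ hδ
      hε0 hε hμ0 hμ1 hμ2 (by linarith) hreg hP hW hdeg' hc (part := part)
      (fun z w hzw => hR _ _ z (hpart z) w (hpart w) hzw) hqK hq
  obtain ⟨ψ, hψ, hrainbow⟩ := h.exists_copy hqX hqadj
  have hqY' : ∀ y ∈ ⋃ i, Y i, K = q y := by
    intro y hy
    obtain ⟨i, hi⟩ := Set.mem_iUnion.1 hy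
    exact (hqY y (hpartY i y hi).2).symm
  have hS := fun y (hy : y ∈ ⋃ i, Y i) => h.exists_distinct_candidates hdeg' hρ (hqY' y hy).le
  choose! S hSA hScard hSdist using hS
  refine ⟨{α | κ α = K}, ψ, S, hrainbow, fun i y hy => ?_, fun i x hx => ?_,
    fun y hy => ⟨?_, fun x hx v hv => ?_⟩, fun y hy x x' hne hx hx' v hv hv1 hv2 hcol => ?_⟩
  · have hyY : y ∈ ⋃ i, Y i := Set.mem_iUnion.2 ⟨i, hy⟩
    have h1 := h.sub y (hqY' y hyY).le
    rw [(hpartY i y hy).1] at h1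
    exact (hSA y hyY).trans h1
  · rw [hψ, ← hpartX i x hx]
    exact h.mem x (hqX x x.2)
  · have h1 := hScard y hy
    have h2 : d' * ((Fintype.card V : ℝ) / r) ≤ β / 4 * ((Fintype.card V : ℝ) / r) := by
      gcongr
    rw [mul_div_assoc]
    linarith
  · obtain ⟨α, hα, hακ⟩ := h.cand y (hqY' y hy).le x hx (hqX x x.2) v (hSA y hy hv)
    obtain ⟨hadj, rfl⟩ := RainbowEmbedding.colourOf_eq_some.1 hα
    rw [hψ]
    exact ⟨hadj, hακ.trans (hqY' y hy).symm⟩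
  · refine hSdist y hy x x' hx hx' (fun h => hne (Subtype.ext h)) (hqX x x.2) (hqX x' x'.2) v hv ?_
    rw [← hψ, ← hψ, RainbowEmbedding.colourOf_of_adj c hv1, RainbowEmbedding.colourOf_of_adj c hv2,
      hcol]
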